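/- Let $n\ge 2$, let $\Omega\subset\mathbb R^n$ be a bounded Lipschitz domain, $T>0$, $\nu>0$, and $Q_T:=\Omega\times(0,T)$. Let $b\in L_2(Q_T;\mathbb R^n)$, $u_0\in L_2(\Omega)$, $f\in L_1(Q_T)$, and assume that $\operatorname{div} b\le 0$ in $\mathcal D'(Q_T)$, i.e. $\int_{Q_T} b\cdot\nabla\eta\,dx\,dt\ge 0$ for every $\eta\in C_0^\infty(Q_T)$ with $\eta\ge 0$, where $\nabla$ is the gradient in $x$. Let $\overset{\circ}{W}{}^1_2(\Omega)$ denote the closure of $C_0^\infty(\Omega)$ in $W^1_2(\Omega)$, and let $u:Q_T\to\mathbb R$ be a weak solution of $$\partial_t u-\nu\Delta u+b\cdot\nabla u=f\ \text{ in } Q_T,\qquad u|_{\partial\Omega\times(0,T)}=0,\qquad u|_{t=0}=u_0,$$ that is, $u\in L_\infty(0,T;L_2(\Omega))\cap L_2(0,T;\overset{\circ}{W}{}^1_2(\Omega))$ and $$\int_{Q_T}\big(-u\,\partial_t\eta+\nu\,\nabla u\cdot\nabla\eta\big)\,dx\,dt+\int_{Q_T} (b\cdot\nabla u)\,\eta\,dx\,dt=\int_\Omega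 u_0(x)\,\eta(x,0)\,dx+\int_{Q_T} f\,\eta\,dx\,dt$$ for every $\eta\in C_0^\infty(\Omega\times[0,T))$. Then $u\in C([0,T];L_1(\Omega))$; that is, there is a continuous function $[0,T]\to L_1(\Omega)$, again denoted by $u$, which coincides with the given $u(\cdot,t)$ for a.e. $t\in(0,T)$, and it satisfies $u(\cdot,0)=u_0$. Moreover, for all $0\le t_1\le t_2\le T$, $$\|u(\cdot,t_2)\|_{L_1(\Omega)}\le\|u(\cdot,t_1)\|_{L_1(\Omega)}+\int_{t_1}^{t_2}\int_\Omega|f(x,t)|\,dx\,dt .$$ In particular, if $f=0$ a.e. in $Q_T$, then $t\mapsto\|u(\cdot,t)\|_{L_1(\Omega)}$ is non-increasing on $[0,T]$. -/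

import Mathlib

open MeasureTheory Set Filter Topology
open scoped ContDiff ENNReal NNReal

noncomputable section

namespace ParabolicDrift

/-- The Euclidean space `ℝⁿ`. -/
abbrev E (n : ℕ) : Type := EuclideanSpace ℝ (Fin n)

/-- Bounded Lipschitz domain: a bounded, nonempty, connected open set which, near each boundary
point and in a suitable orthonormal frame with "vertical" unit vector `e`, is the strict
supergraph of a Lipschitz function `γ` of the "horizontal" component of `x`. -/
structure IsBoundedLipschitzDomain {n : ℕ} (Ω : Set (E n)) : Prop where
  isOpen : IsOpen Ω
  isConnected : IsConnected Ω
  isBounded : Bornology.IsBounded Ω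
  lipschitz_boundary : ∀ x₀ ∈ frontier Ω, ∃ (e : E n) (r : ℝ) (K : ℝ≥0) (γ : E n → ℝ),
    ‖e‖ = 1 ∧ 0 < r ∧ LipschitzWith K γ ∧
      ∀ x ∈ Metric.ball x₀ r, (x ∈ Ω ↔ γ (x - inner ℝ x e • e) < inner ℝ x e)

/-- The space-time cylinder `Q_T = Ω × (0,T)`. -/
def cylinder {n : ℕ} (Ω : Set (E n)) (T : ℝ) : Set (E n × ℝ) := Ω ×ˢ Ioo 0 T

/-- `φ ∈ C_0^∞(U)`: smooth with compact support contained in `U`. -/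
structure IsTestFunction {V : Type*} [NormedAddCommGroup V] [NormedSpace ℝ V]
    (U : Set V) (φ : V → ℝ) : Prop where
  contDiff : ContDiff ℝ ∞ φ
  hasCompactSupport : HasCompactSupport φ
  tsupport_subset : tsupport φ ⊆ U

/-- Spatial gradient `∇η(x,t)` of a function of `(x,t)`. -/
def gradX {n : ℕ} (η : E n × ℝ → ℝ) (z : E n × ℝ) : E n :=
  gradient (fun y => η (y, z.2)) z.1

/-- Time derivative `∂_t η(x,t)` of a function of `(x,t)`. -/
def derivT {n : ℕ} (η : E n × ℝ → ℝ) (z : E n × ℝ) : ℝ :=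
  deriv (fun s => η (z.1, s)) z.2

/-- `g` is the weak gradient of `v` in `Ω`. -/
def HasWeakGradient {n : ℕ} (Ω : Set (E n)) (v : E n → ℝ) (g : E n → E n) : Prop :=
  ∀ φ : E n → ℝ, IsTestFunction Ω φ →
    ∀ i : Fin n, ∫ x in Ω, v x * gradient φ x i = -∫ x in Ω, g x i * φ x

/-- `v ∈ W^1_2(Ω)` with weak gradient `g`. -/
structure MemW12 {n : ℕ} (Ω : Set (E n)) (v : E n → ℝ) (g : E n → E n) : Prop where
  memLp : MemLp v 2 (volume.restrict Ω)
  memLp_grad : MemLp g 2 (volume.restrict Ω)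
  weakGradient : HasWeakGradient Ω v g

/-- `v ∈ W̊^1_2(Ω)` with weak gradient `g`: `v` belongs to the closure of `C_0^∞(Ω)` in the
norm of `W^1_2(Ω)`. -/
structure MemW12Zero {n : ℕ} (Ω : Set (E n)) (v : E n → ℝ) (g : E n → E n) : Prop where
  memW12 : MemW12 Ω v g
  mem_closure : ∃ φ : ℕ → E n → ℝ, (∀ k, IsTestFunction Ω (φ k)) ∧
    Tendsto (fun k => eLpNorm (fun x => φ k x - v x) 2 (volume.restrict Ω)) atTop (𝓝 0) ∧
    Tendsto (fun k => eLpNorm (fun x => gradient (φ k) x - g x) 2 (volume.restrict Ω))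
      atTop (𝓝 0)

/-- The energy class `u ∈ L_∞(0,T; L_2(Ω)) ∩ L_2(0,T; W̊^1_2(Ω))`, where `G = ∇u` is the
spatial gradient of `u`. -/
structure MemEnergyClass {n : ℕ} (Ω : Set (E n)) (T : ℝ) (u : E n × ℝ → ℝ)
    (G : E n × ℝ → E n) : Prop where
  memLp : MemLp u 2 (volume.restrict (cylinder Ω T))
  memLp_grad : MemLp G 2 (volume.restrict (cylinder Ω T))
  essBounded : ∃ M : ℝ≥0, ∀ᵐ t ∂(volume.restrict (Ioo (0 : ℝ) T)),
    eLpNorm (fun x => u (x, t)) 2 (volume.restrict Ω) ≤ M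
  memW12Zero : ∀ᵐ t ∂(volume.restrict (Ioo (0 : ℝ) T)),
    MemW12Zero Ω (fun x => u (x, t)) (fun x => G (x, t))

/-- `div b ≤ 0` in the sense of distributions on `Q_T`. -/
def DivNonpos {n : ℕ} (Ω : Set (E n)) (T : ℝ) (b : E n × ℝ → E n) : Prop :=
  ∀ η : E n × ℝ → ℝ, IsTestFunction (cylinder Ω T) η → (∀ z, 0 ≤ η z) →
    0 ≤ ∫ z in cylinder Ω T, inner ℝ (b z) (gradX η z)

/-- Weak solution of `∂_t u - ν Δu + b·∇u = f` in `Q_T`, `u = 0` on `∂Ω × (0,T)`,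
`u = u₀` at `t = 0`. The test functions `η ∈ C_0^∞(Ω × [0,T))` are the restrictions to `t ≥ 0`
of functions in `C_0^∞(Ω × (-∞,T))`. -/
def IsWeakSolution {n : ℕ} (Ω : Set (E n)) (T ν : ℝ) (b : E n × ℝ → E n) (u₀ : E n → ℝ)
    (f : E n × ℝ → ℝ) (u : E n × ℝ → ℝ) : Prop :=
  ∃ G : E n × ℝ → E n, MemEnergyClass Ω T u G ∧
    ∀ η : E n × ℝ → ℝ, IsTestFunction (Ω ×ˢ Iio T) η →
      (∫ z in cylinder Ω T, (-(u z * derivT η z) + ν * inner ℝ (G z) (gradX η z))) +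
          (∫ z in cylinder Ω T, inner ℝ (b z) (G z) * η z) =
        (∫ x in Ω, u₀ x * η (x, 0)) + ∫ z in cylinder Ω T, f z * η z

end ParabolicDrift

end

/-!
The solution is treated as a curve `t ↦ u(t)` in `L₁(Ω)` solving `∂ₜu - νΔu = g` with
`g = f - b·∇u ∈ L₁(Q_T)`. Mollifying in time with a kernel supported in `(0, ∞)`, which looks only
into the past, keeps the equation valid on all of `(0, T]` and turns it, at each fixed time, into
an identity between elements of `L₁(Ω)` and the weak Laplacian.

The entropies `∫ S_ε(u)` with `S_ε(r) = √(r² + ε²) - ε` approximate the `L₁` norm, and convexity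
of `S_ε` gives the diffusion the good sign. Hence the mollified curves contract in `L₁` up to the
mass of their sources, which vanishes for the difference of two of them. The initial jump of this
difference is a multiple of `u₀`; subtracting a test function close to `u₀` in `L₁` removes it, up
to a small error and a source coming from the Laplacian of the test function. So the mollified
curves converge uniformly on `[0, T]`, and their limit is the continuous representative.

The drift contributes `-∫ S_ε'(u) b·∇u = -∫ b·∇S_ε(u)` to the derivative of the entropy. As
`S_ε(u) ≥ 0` vanishes on `∂Ω`, it is nonpositive when `div b ≤ 0`, so that only `f` is left.
-/

noncomputable section

open scoped Convolution Laplacian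

namespace ParabolicDrift

section Mollification

theorem IsTestFunction.mono {V : Type*} [NormedAddCommGroup V] [NormedSpace ℝ V] {U U' : Set V}
    {φ : V → ℝ} (hφ : IsTestFunction U φ) (hU : U ⊆ U') : IsTestFunction U' φ :=
  ⟨hφ.contDiff, hφ.hasCompactSupport, hφ.tsupport_subset.trans hU⟩

theorem IsTestFunction.eq_zero_of_notMem {V : Type*} [NormedAddCommGroup V] [NormedSpace ℝ V]
    {U : Set V} {φ : V → ℝ} (hφ : IsTestFunction U φ) {x : V} (hx : x ∉ U) : φ x = 0 :=
  image_eq_zero_of_notMem_tsupport fun h => hx (hφ.tsupport_subset h)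

variable {V : Type*} [NormedAddCommGroup V] [NormedSpace ℝ V]

theorem IsTestFunction.integrable {U : Set ℝ} {ρ : ℝ → ℝ} (hρ : IsTestFunction U ρ) :
    Integrable ρ :=
  hρ.contDiff.continuous.integrable_of_hasCompactSupport hρ.hasCompactSupport

theorem IsTestFunction.deriv {U : Set ℝ} {ρ : ℝ → ℝ} (hρ : IsTestFunction U ρ) :
    IsTestFunction U (deriv ρ) where
  contDiff := (contDiff_infty_iff_deriv.1 hρ.contDiff).2
  hasCompactSupport := hρ.hasCompactSupport.deriv
  tsupport_subset := tsupport_deriv_subset.trans hρ.tsupport_subset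

theorem IsTestFunction.hasDerivAt_convolution {U : Set ℝ} {ρ : ℝ → ℝ} (hρ : IsTestFunction U ρ)
    {F : ℝ → V} (hF : Integrable F) (t : ℝ) : HasDerivAt (ρ ⋆ F) ((_root_.deriv ρ ⋆ F) t) t :=
  hρ.hasCompactSupport.hasDerivAt_convolution_left _ (hρ.contDiff.of_le (by simp))
    hF.locallyIntegrable t

theorem IsTestFunction.continuous_convolution {U : Set ℝ} {ρ : ℝ → ℝ} (hρ : IsTestFunction U ρ)
    {F : ℝ → V} (hF : Integrable F) : Continuous (ρ ⋆ F) :=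
  hρ.hasCompactSupport.continuous_convolution_left _ hρ.contDiff.continuous hF.locallyIntegrable

theorem IsTestFunction.integrable_smul {U : Set ℝ} {ρ : ℝ → ℝ} (hρ : IsTestFunction U ρ)
    {F : ℝ → V} (hF : Integrable F) (t : ℝ) : Integrable fun s => ρ (t - s) • F s := by
  obtain ⟨C, hC⟩ := hρ.contDiff.continuous.bounded_above_of_compact_support hρ.hasCompactSupport
  exact hF.bdd_smul C
    (hρ.contDiff.continuous.comp (continuous_sub_left t)).aestronglyMeasurable
    (ae_of_all _ fun s => hC (t - s))

theorem IsTestFunction.sub_convolution {U : Set ℝ} {ρ σ : ℝ → ℝ} (hρ : IsTestFunction U ρ)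
    (hσ : IsTestFunction U σ) {F : ℝ → V} (hF : Integrable F) (t : ℝ) :
    ((fun s => ρ s - σ s) ⋆ F) t = (ρ ⋆ F) t - (σ ⋆ F) t := by
  simp only [convolution_lsmul_swap, sub_smul]
  exact integral_sub (hρ.integrable_smul hF t) (hσ.integrable_smul hF t)

theorem IsTestFunction.convolution_sub {U : Set ℝ} {ρ : ℝ → ℝ} (hρ : IsTestFunction U ρ)
    {F K : ℝ → V} (hF : Integrable F) (hK : Integrable K) (t : ℝ) :
    (ρ ⋆ fun s => F s - K s) t = (ρ ⋆ F) t - (ρ ⋆ K) t := by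
  simp only [convolution_lsmul_swap, smul_sub]
  exact integral_sub (hρ.integrable_smul hF t) (hρ.integrable_smul hK t)

theorem norm_convolution_le (ρ : ℝ → ℝ) (F : ℝ → V) (t : ℝ) :
    ‖(ρ ⋆ F) t‖ ≤ ((fun s => ‖ρ s‖) ⋆ fun s => ‖F s‖) t :=
  (norm_integral_le_integral_norm _).trans_eq (by simp [convolution, norm_smul])

theorem integral_norm_convolution_le {ρ : ℝ → ℝ} {F : ℝ → V} (hρ : Integrable ρ)
    (hF : Integrable F) : ∫ t, ‖(ρ ⋆ F) t‖ ≤ (∫ t, ‖ρ t‖) * ∫ t, ‖F t‖ :=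
  calc ∫ t, ‖(ρ ⋆ F) t‖ ≤ ∫ t, ((fun s => ‖ρ s‖) ⋆ fun s => ‖F s‖) t :=
        integral_mono (hρ.integrable_convolution _ hF).norm
          (hρ.norm.integrable_convolution _ hF.norm) (norm_convolution_le ρ F)
    _ = (∫ t, ‖ρ t‖) * ∫ t, ‖F t‖ := integral_convolution _ hρ.norm hF.norm

theorem integral_mem_of_isClosed [CompleteSpace V] {X : Type*} [MeasurableSpace X] {μ : Measure X}
    {K : Submodule ℝ V} (hK : IsClosed (K : Set V)) {F : X → V} (hF : ∀ᵐ x ∂μ, F x ∈ K) :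
    ∫ x, F x ∂μ ∈ K := by
  by_cases hint : Integrable F μ
  · have : IsClosed (K : Set V) := hK
    rw [← Submodule.Quotient.mk_eq_zero]
    change K.mkQL (∫ x, F x ∂μ) = 0
    rw [← K.mkQL.integral_comp_comm hint]
    exact integral_eq_zero_of_ae (hF.mono fun x hx => (Submodule.Quotient.mk_eq_zero K).2 hx)
  · rw [integral_undef hint]
    exact K.zero_mem

theorem convolution_mem_of_isClosed [CompleteSpace V] {K : Submodule ℝ V}
    (hK : IsClosed (K : Set V)) {F : ℝ → V} (hF : ∀ᵐ s, F s ∈ K) (ρ : ℝ → ℝ) (t : ℝ) :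
    (ρ ⋆ F) t ∈ K := by
  rw [convolution_lsmul_swap]
  exact integral_mem_of_isClosed hK (hF.mono fun s hs => K.smul_mem _ hs)

/-- A standard mollifier in time which looks only into the past: a smooth probability density
supported in the interval `[1/(m+1), 3/(m+1)]`. -/
def timeKernel (m : ℕ) : ℝ → ℝ :=
  ContDiffBump.normed (⟨1 / (2 * (m + 1)), 1 / (m + 1), by positivity, by
    gcongr; linarith⟩ : ContDiffBump (2 / ((m : ℝ) + 1))) volume

theorem tsupport_timeKernel (m : ℕ) :
    tsupport (timeKernel m) = Icc (1 / ((m : ℝ) + 1)) (3 / (m + 1)) := by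
  rw [timeKernel, ContDiffBump.tsupport_normed_eq, Real.closedBall_eq_Icc]
  congr 1 <;> ring

theorem isTestFunction_timeKernel (m : ℕ) : IsTestFunction (Ioi 0) (timeKernel m) where
  contDiff := ContDiffBump.contDiff_normed _
  hasCompactSupport := ContDiffBump.hasCompactSupport_normed _
  tsupport_subset := by
    rw [tsupport_timeKernel]
    exact fun t ht => lt_of_lt_of_le (by positivity : (0 : ℝ) < 1 / (m + 1)) ht.1

theorem timeKernel_nonneg (m : ℕ) (t : ℝ) : 0 ≤ timeKernel m t :=
  ContDiffBump.nonneg_normed _ t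

theorem integral_timeKernel (m : ℕ) : ∫ t, timeKernel m t = 1 :=
  ContDiffBump.integral_normed _

theorem integral_norm_timeKernel (m : ℕ) : ∫ t, ‖timeKernel m t‖ = 1 := by
  simp only [Real.norm_of_nonneg (timeKernel_nonneg m _), integral_timeKernel]

theorem tendsto_tsupport_timeKernel :
    Tendsto (fun m => tsupport (timeKernel m)) atTop (𝓝 0).smallSets := by
  refine tendsto_smallSets_iff.2 fun U hU => ?_
  obtain ⟨r, hr, hrU⟩ := Metric.mem_nhds_iff.1 hU
  have hlim : Tendsto (fun m : ℕ => 3 * (1 / ((m : ℝ) + 1))) atTop (𝓝 0) := by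
    simpa using tendsto_one_div_add_atTop_nhds_zero_nat.const_mul (3 : ℝ)
  filter_upwards [hlim.eventually_lt_const hr] with m hm t ht
  rw [tsupport_timeKernel] at ht
  have h0 : 0 < t := lt_of_lt_of_le (by positivity) ht.1
  refine hrU ?_
  rw [Metric.mem_ball, Real.dist_0_eq_abs, abs_of_pos h0]
  calc t ≤ 3 * (1 / ((m : ℝ) + 1)) := by simpa [div_eq_mul_inv] using ht.2
    _ < r := hm

theorem eventually_isTestFunction_timeKernel {t : ℝ} (ht : 0 < t) :
    ∀ᶠ m in atTop, IsTestFunction (Ioo 0 t) (timeKernel m) := by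
  filter_upwards [tendsto_smallSets_iff.1 tendsto_tsupport_timeKernel (Iio t) (Iio_mem_nhds ht)]
    with m hm
  have hρ := isTestFunction_timeKernel m
  exact ⟨hρ.contDiff, hρ.hasCompactSupport, fun s hs => ⟨hρ.tsupport_subset hs, hm hs⟩⟩

theorem tendsto_convolution_timeKernel_of_continuous [CompleteSpace V] {F : ℝ → V}
    (hF : Continuous F) (t : ℝ) : Tendsto (fun m => (timeKernel m ⋆ F) t) atTop (𝓝 (F t)) :=
  convolution_tendsto_right (.of_forall timeKernel_nonneg) (.of_forall integral_timeKernel)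
    (tendsto_tsupport_timeKernel.smallSets_mono (.of_forall fun _ => subset_tsupport _))
    (.of_forall fun _ => hF.aestronglyMeasurable)
    ((hF.tendsto t).comp tendsto_snd) tendsto_const_nhds

theorem convolution_timeKernel_eq_zero {F : ℝ → V} {R : ℝ} (hF : ∀ s, R < |s| → F s = 0) (m : ℕ)
    {t : ℝ} (ht : R + 3 < |t|) : (timeKernel m ⋆ F) t = 0 := by
  rw [convolution_lsmul]
  refine integral_eq_zero_of_ae (ae_of_all _ fun s => ?_)
  by_cases hs : timeKernel m s = 0
  · simp [hs]
  have hmem : s ∈ Icc (1 / ((m : ℝ) + 1)) (3 / (m + 1)) :=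
    tsupport_timeKernel m ▸ subset_tsupport _ hs
  have h0 : 0 < s := lt_of_lt_of_le (by positivity) hmem.1
  have h3 : s ≤ 3 := hmem.2.trans (div_le_self (by norm_num) (by linarith [m.cast_nonneg (α := ℝ)]))
  have : R < |t - s| := by linarith [abs_sub_abs_le_abs_sub t s, abs_of_pos h0]
  simp [hF _ this]

theorem tendsto_integral_norm_convolution_sub_of_hasCompactSupport [CompleteSpace V] {F : ℝ → V}
    (hF : Continuous F) (hFc : HasCompactSupport F) :
    Tendsto (fun m => ∫ t, ‖(timeKernel m ⋆ F) t - F t‖) atTop (𝓝 0) := by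
  obtain ⟨C, hC⟩ := hF.bounded_above_of_compact_support hFc
  obtain ⟨R, hR⟩ := hFc.isCompact.isBounded.subset_closedBall (0 : ℝ)
  have hF0 : ∀ s, R < |s| → F s = 0 := fun s hs => image_eq_zero_of_notMem_tsupport fun h =>
    hs.not_ge (by simpa using hR h)
  have hC' : ∀ m t, ‖(timeKernel m ⋆ F) t‖ ≤ C := fun m t => by
    rw [convolution_lsmul]
    refine (norm_integral_le_of_norm_le
      ((isTestFunction_timeKernel m).integrable.mul_const C) (ae_of_all _ fun s => ?_)).trans_eq
      (by rw [integral_mul_const, integral_timeKernel, one_mul])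
    rw [norm_smul, Real.norm_of_nonneg (timeKernel_nonneg m s)]
    exact mul_le_mul_of_nonneg_left (hC _) (timeKernel_nonneg m s)
  have hbound : ∀ m t, ‖‖(timeKernel m ⋆ F) t - F t‖‖ ≤
      (Icc (-(R + 3)) (R + 3)).indicator (fun _ => 2 * C) t := fun m t => by
    rw [norm_norm]
    by_cases ht : t ∈ Icc (-(R + 3)) (R + 3)
    · rw [indicator_of_mem ht]
      linarith [norm_sub_le ((timeKernel m ⋆ F) t) (F t), hC' m t, hC t]
    · have ht' : R + 3 < |t| := lt_of_not_ge fun h => ht (abs_le.1 h)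
      rw [indicator_of_notMem ht, convolution_timeKernel_eq_zero hF0 m ht',
        hF0 t (by linarith), sub_zero, norm_zero]
  have hlim := tendsto_integral_of_dominated_convergence (μ := volume) (f := fun _ => (0 : ℝ))
    (bound := (Icc (-(R + 3)) (R + 3)).indicator (fun _ => 2 * C))
    (fun m => (((isTestFunction_timeKernel m).continuous_convolution
      (hF.integrable_of_hasCompactSupport hFc)).sub hF).norm.aestronglyMeasurable)
    ((integrable_indicator_iff measurableSet_Icc).2 (integrableOn_const (by simp)))
    (fun m => ae_of_all _ (hbound m))
    (ae_of_all _ fun t => by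
      simpa using ((tendsto_convolution_timeKernel_of_continuous hF t).sub_const (F t)).norm)
  simpa using hlim

theorem integral_norm_convolution_sub_le {F K : ℝ → V} (hF : Integrable F) (hK : Integrable K)
    (m : ℕ) : ∫ t, ‖(timeKernel m ⋆ F) t - F t‖ ≤
      (∫ t, ‖(timeKernel m ⋆ K) t - K t‖) + 2 * ∫ t, ‖F t - K t‖ := by
  have hρ := isTestFunction_timeKernel m
  have hconv : ∀ {f : ℝ → V}, Integrable f → Integrable (timeKernel m ⋆ f) :=
    fun hf => hρ.integrable.integrable_convolution _ hf
  have hFK : Integrable fun t => F t - K t := hF.sub hK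
  have hFKi : Integrable fun t => ‖F t - K t‖ := hFK.norm
  have hconvFK : Integrable fun t => ‖(timeKernel m ⋆ fun s => F s - K s) t‖ := (hconv hFK).norm
  have hconvK : Integrable fun t => ‖(timeKernel m ⋆ K) t - K t‖ := ((hconv hK).sub hK).norm
  have hpt : ∀ t, ‖(timeKernel m ⋆ F) t - F t‖ ≤ ‖(timeKernel m ⋆ K) t - K t‖ +
      (‖(timeKernel m ⋆ fun s => F s - K s) t‖ + ‖F t - K t‖) := fun t => by
    rw [hρ.convolution_sub hF hK]
    calc ‖(timeKernel m ⋆ F) t - F t‖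
      _ = ‖((timeKernel m ⋆ K) t - K t) +
            (((timeKernel m ⋆ F) t - (timeKernel m ⋆ K) t) - (F t - K t))‖ := by congr 1; abel
      _ ≤ _ := (norm_add_le _ _).trans (by gcongr; exact norm_sub_le _ _)
  calc ∫ t, ‖(timeKernel m ⋆ F) t - F t‖
    _ ≤ ∫ t, (‖(timeKernel m ⋆ K) t - K t‖ +
          (‖(timeKernel m ⋆ fun s => F s - K s) t‖ + ‖F t - K t‖)) :=
        integral_mono ((hconv hF).sub hF).norm (hconvK.add (hconvFK.add hFKi)) hpt
    _ = (∫ t, ‖(timeKernel m ⋆ K) t - K t‖) +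
          ((∫ t, ‖(timeKernel m ⋆ fun s => F s - K s) t‖) + ∫ t, ‖F t - K t‖) := by
        rw [← integral_add hconvFK hFKi]
        exact integral_add hconvK (hconvFK.add hFKi)
    _ ≤ _ := by
        have h := integral_norm_convolution_le hρ.integrable hFK
        rw [integral_norm_timeKernel, one_mul] at h
        linarith

theorem tendsto_integral_norm_convolution_sub [CompleteSpace V] {F : ℝ → V} (hF : Integrable F) :
    Tendsto (fun m => ∫ t, ‖(timeKernel m ⋆ F) t - F t‖) atTop (𝓝 0) := by
  refine tendsto_order.2 ⟨fun a ha => .of_forall fun m =>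
    ha.trans_le (integral_nonneg fun _ => norm_nonneg _), fun δ hδ => ?_⟩
  obtain ⟨K, hKc, hFK, hK, hKi⟩ :=
    hF.exists_hasCompactSupport_integral_sub_le (show 0 < δ / 4 by positivity)
  filter_upwards [(tendsto_integral_norm_convolution_sub_of_hasCompactSupport hK
    hKc).eventually_lt_const (half_pos hδ)] with m hm
  linarith [integral_norm_convolution_sub_le hF hKi m]

theorem exists_seq_tendsto_ae_of_tendsto_integral_norm_sub {X W : Type*} [MeasurableSpace X]
    [NormedAddCommGroup W] {μ : Measure X} {F : ℕ → X → W} {K : X → W}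
    (hF : ∀ m, Integrable (F m) μ) (hK : Integrable K μ)
    (hFK : Tendsto (fun m => ∫ t, ‖F m t - K t‖ ∂μ) atTop (𝓝 0)) :
    ∃ ns : ℕ → ℕ, StrictMono ns ∧ ∀ᵐ t ∂μ, Tendsto (fun k => F (ns k) t) atTop (𝓝 (K t)) := by
  have hnorm : ∀ m, eLpNorm (F m - K) 1 μ = ENNReal.ofReal (∫ t, ‖F m t - K t‖ ∂μ) := fun m => by
    rw [eLpNorm_one_eq_lintegral_enorm, ← ofReal_integral_norm_eq_lintegral_enorm ((hF m).sub hK)]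
    rfl
  refine (tendstoInMeasure_of_tendsto_eLpNorm one_ne_zero (fun m => (hF m).1) hK.1
    ?_).exists_seq_tendsto_ae
  simpa only [hnorm, ENNReal.ofReal_zero] using ENNReal.tendsto_ofReal hFK

theorem exists_seq_tendsto_ae_convolution_timeKernel [CompleteSpace V] {F : ℝ → V}
    (hF : Integrable F) : ∃ ns : ℕ → ℕ, StrictMono ns ∧
      ∀ᵐ t, Tendsto (fun k => (timeKernel (ns k) ⋆ F) t) atTop (𝓝 (F t)) :=
  exists_seq_tendsto_ae_of_tendsto_integral_norm_sub
    (fun m => (isTestFunction_timeKernel m).integrable.integrable_convolution _ hF) hF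
    (tendsto_integral_norm_convolution_sub hF)

end Mollification

section Slices

theorem measurable_of_measurable_edist {Y Z : Type*} [MeasurableSpace Y] [PseudoEMetricSpace Z]
    [SecondCountableTopology Z] [MeasurableSpace Z] [BorelSpace Z] {F : Y → Z}
    (hF : ∀ c, Measurable fun t => edist (F t) c) : Measurable F := by
  have hbasis : TopologicalSpace.IsTopologicalBasis
      {B : Set Z | ∃ c r, B = Metric.eball c r} := by
    refine TopologicalSpace.isTopologicalBasis_of_isOpen_of_nhds ?_ fun c U hc hU => ?_
    · rintro _ ⟨c, r, rfl⟩
      exact Metric.isOpen_eball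
    · obtain ⟨r, hr, hrU⟩ := EMetric.mem_nhds_iff.1 (hU.mem_nhds hc)
      exact ⟨_, ⟨c, r, rfl⟩, Metric.mem_eball_self hr, hrU⟩
  rw [BorelSpace.measurable_eq (α := Z), hbasis.borel_eq_generateFrom]
  refine measurable_generateFrom ?_
  rintro _ ⟨c, r, rfl⟩
  exact hF c measurableSet_Iio

variable {X Y V : Type*} [MeasurableSpace X] [NormedAddCommGroup V] {p : ℝ≥0∞} {μ : Measure X}

open Classical in
/-- The slice `F(·, t)` of a function of two variables, as an element of `L_p`; by convention it
is `0` for those `t` for which `F(·, t)` is not in `L_p`. -/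
def slice (p : ℝ≥0∞) (μ : Measure X) (F : X × Y → V) (t : Y) : Lp V p μ :=
  if h : MemLp (fun x => F (x, t)) p μ then h.toLp else 0

theorem slice_ae_eq {F : X × Y → V} {t : Y} (h : MemLp (fun x => F (x, t)) p μ) :
    slice p μ F t =ᵐ[μ] fun x => F (x, t) := by
  rw [slice, dif_pos h]
  exact h.coeFn_toLp

theorem edist_slice {F : X × Y → V} {t : Y} (h : MemLp (fun x => F (x, t)) p μ) (c : Lp V p μ) :
    edist (slice p μ F t) c = eLpNorm (fun x => F (x, t) - c x) p μ := by
  rw [Lp.edist_def]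
  exact eLpNorm_congr_ae ((slice_ae_eq h).sub (ae_eq_refl c))

variable [MeasurableSpace Y] {τ : Measure Y}

theorem ae_ae_of_ae_prod_right [SFinite μ] [SFinite τ] {P : X × Y → Prop}
    (h : ∀ᵐ z ∂μ.prod τ, P z) : ∀ᵐ t ∂τ, ∀ᵐ x ∂μ, P (x, t) :=
  Measure.ae_ae_of_ae_prod (Measure.measurePreserving_swap.quasiMeasurePreserving.ae h)

theorem slice_congr_ae [SFinite μ] [SFinite τ] {F K : X × Y → V} (h : F =ᵐ[μ.prod τ] K) :
    slice p μ F =ᵐ[τ] slice p μ K := by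
  filter_upwards [ae_ae_of_ae_prod_right h] with t ht
  have ht' : (fun x => F (x, t)) =ᵐ[μ] fun x => K (x, t) := ht
  by_cases hF : MemLp (fun x => F (x, t)) p μ
  · have hK := (memLp_congr_ae ht').1 hF
    rw [slice, slice, dif_pos hF, dif_pos hK]
    exact MemLp.toLp_congr hF hK ht'
  · rw [slice, slice, dif_neg hF, dif_neg (mt (memLp_congr_ae ht').2 hF)]

theorem measurable_eLpNorm_prodMk_right [SFinite μ] (hp₀ : p ≠ 0) (hp : p ≠ ⊤) {F : X × Y → V}
    (hF : StronglyMeasurable F) : Measurable fun t => eLpNorm (fun x => F (x, t)) p μ := by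
  simp only [eLpNorm_eq_lintegral_rpow_enorm_toReal hp₀ hp]
  exact (hF.enorm.pow_const _).lintegral_prod_left'.pow_const _

theorem lintegral_eLpNorm_rpow [SFinite μ] [SFinite τ] (hp₀ : p ≠ 0) (hp : p ≠ ⊤) {F : X × Y → V}
    (hF : AEStronglyMeasurable F (μ.prod τ)) :
    ∫⁻ t, eLpNorm (fun x => F (x, t)) p μ ^ p.toReal ∂τ = eLpNorm F p (μ.prod τ) ^ p.toReal := by
  have hpos : p.toReal ≠ 0 := (ENNReal.toReal_pos hp₀ hp).ne'
  simp only [eLpNorm_eq_lintegral_rpow_enorm_toReal hp₀ hp, ← ENNReal.rpow_mul,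
    one_div_mul_cancel hpos, ENNReal.rpow_one]
  exact (lintegral_prod_symm _ (hF.enorm.pow_const _)).symm

theorem ae_memLp_prodMk_right [SFinite μ] [SFinite τ] (hp₀ : p ≠ 0) (hp : p ≠ ⊤) {F : X × Y → V}
    (hF : MemLp F p (μ.prod τ)) : ∀ᵐ t ∂τ, MemLp (fun x => F (x, t)) p μ := by
  have hpos : 0 < p.toReal := ENNReal.toReal_pos hp₀ hp
  obtain ⟨K, hK, hFK⟩ := hF.1
  have hfin : ∀ᵐ t ∂τ, eLpNorm (fun x => K (x, t)) p μ ^ p.toReal < ⊤ := by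
    refine ae_lt_top ((measurable_eLpNorm_prodMk_right hp₀ hp hK).pow_const _) ?_
    rw [lintegral_eLpNorm_rpow hp₀ hp hK.aestronglyMeasurable, ← eLpNorm_congr_ae hFK]
    exact (ENNReal.rpow_lt_top_of_nonneg hpos.le hF.2.ne).ne
  filter_upwards [hfin, ae_ae_of_ae_prod_right hFK] with t ht hFKt
  exact (memLp_congr_ae hFKt).2 ⟨(hK.comp_measurable measurable_prodMk_right).aestronglyMeasurable,
    (ENNReal.rpow_lt_top_iff_of_pos hpos).1 ht⟩

variable [Fact (1 ≤ p)] [hp : Fact (p ≠ ⊤)]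

theorem aestronglyMeasurable_slice [SFinite μ] [SFinite τ] [IsSeparable μ]
    [TopologicalSpace.SeparableSpace V] {F : X × Y → V} (hF : AEStronglyMeasurable F (μ.prod τ)) :
    AEStronglyMeasurable (slice p μ F) τ := by
  classical
  have hp₀ : p ≠ 0 := (zero_lt_one.trans_le Fact.out).ne'
  obtain ⟨K, hK, hFK⟩ := hF
  refine AEStronglyMeasurable.congr ?_ (slice_congr_ae hFK).symm
  borelize ↥(Lp V p μ)
  refine (measurable_of_measurable_edist fun c => ?_).stronglyMeasurable.aestronglyMeasurable
  have hKm : ∀ t, AEStronglyMeasurable (fun x => K (x, t)) μ := fun t =>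
    (hK.comp_measurable measurable_prodMk_right).aestronglyMeasurable
  have hite : (fun t => edist (slice p μ K t) c) = fun t =>
      if eLpNorm (fun x => K (x, t)) p μ < ⊤ then eLpNorm (fun x => K (x, t) - c x) p μ
      else edist 0 c := by
    funext t
    split_ifs with h
    · exact edist_slice ⟨hKm t, h⟩ c
    · rw [slice, dif_neg fun hmem => h hmem.2]
  rw [hite]
  refine Measurable.ite
    (measurableSet_lt (measurable_eLpNorm_prodMk_right hp₀ hp.out hK) measurable_const)
    (measurable_eLpNorm_prodMk_right hp₀ hp.out (F := fun z => K z - c z.1)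
      (hK.sub ((Lp.stronglyMeasurable c).comp_measurable measurable_fst))) measurable_const

theorem memLp_slice [SFinite μ] [SFinite τ] [IsSeparable μ] [TopologicalSpace.SeparableSpace V]
    {F : X × Y → V} (hF : MemLp F p (μ.prod τ)) : MemLp (slice p μ F) p τ := by
  have hp₀ : p ≠ 0 := (zero_lt_one.trans_le Fact.out).ne'
  have hpos : 0 < p.toReal := ENNReal.toReal_pos hp₀ hp.out
  refine ⟨aestronglyMeasurable_slice hF.1, ?_⟩
  rw [eLpNorm_eq_lintegral_rpow_enorm_toReal hp₀ hp.out]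
  refine ENNReal.rpow_lt_top_of_nonneg (by positivity) (ne_of_lt ?_)
  have hnorm : ∀ᵐ t ∂τ, ‖slice p μ F t‖ₑ = eLpNorm (fun x => F (x, t)) p μ := by
    filter_upwards [ae_memLp_prodMk_right hp₀ hp.out hF] with t ht
    rw [Lp.enorm_def, eLpNorm_congr_ae (slice_ae_eq ht)]
  rw [lintegral_congr_ae (hnorm.mono fun t ht => congrArg (· ^ p.toReal) ht),
    lintegral_eLpNorm_rpow hp₀ hp.out hF.1]
  exact ENNReal.rpow_lt_top_of_nonneg hpos.le hF.2.ne

theorem integrable_indicator_slice [SFinite μ] [IsSeparable μ] [TopologicalSpace.SeparableSpace V]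
    {F : X × ℝ → V} {I : Set ℝ} (hI : MeasurableSet I) (hIfin : volume I ≠ ⊤)
    (hF : MemLp F p (μ.prod (volume.restrict I))) : Integrable (I.indicator (slice p μ F)) := by
  have : IsFiniteMeasure (volume.restrict I) := isFiniteMeasure_restrict.2 hIfin
  exact (integrable_indicator_iff hI).2 ((memLp_slice hF).integrable Fact.out)

theorem IsTestFunction.integrable_comp_sub_mul_inner {H : Type*} [NormedAddCommGroup H]
    [InnerProductSpace ℝ H] {p q : ℝ≥0∞} [p.HolderConjugate q] {τ : Measure ℝ} [IsFiniteMeasure τ]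
    {F : X × ℝ → H} (hF : MemLp F p (μ.prod τ)) {k : X → H} (hk : MemLp k q μ)
    {U : Set ℝ} {ρ : ℝ → ℝ} (hρ : IsTestFunction U ρ) (t : ℝ) :
    Integrable (fun z : X × ℝ => ρ (t - z.2) * inner ℝ (F z) (k z.1)) (μ.prod τ) := by
  obtain ⟨C, hC⟩ := hρ.contDiff.continuous.bounded_above_of_compact_support hρ.hasCompactSupport
  refine Integrable.bdd_mul (c := C) (memLp_one_iff_integrable.1 ?_)
    (hρ.contDiff.continuous.measurable.comp
      (measurable_const.sub measurable_snd)).aestronglyMeasurable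
    (ae_of_all _ fun z => hC (t - z.2))
  exact (innerSL ℝ (E := H)).memLp_of_bilin (r := 1) hF (hk.comp_fst _)

theorem integral_inner_convolution_indicator_slice {H : Type*} [NormedAddCommGroup H]
    [InnerProductSpace ℝ H] [CompleteSpace H] [TopologicalSpace.SeparableSpace H] [SFinite μ]
    [IsSeparable μ] {q : ℝ≥0∞} [Fact (1 ≤ q)] [p.HolderConjugate q] {I : Set ℝ}
    (hI : MeasurableSet I) (hIfin : volume I ≠ ⊤) {F : X × ℝ → H}
    (hF : MemLp F p (μ.prod (volume.restrict I))) {k : X → H} (hk : MemLp k q μ) {U : Set ℝ}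
    {ρ : ℝ → ℝ} (hρ : IsTestFunction U ρ) (t : ℝ) :
    ∫ x, inner ℝ ((ρ ⋆ I.indicator (slice p μ F)) t x) (k x) ∂μ =
      ∫ z, ρ (t - z.2) * inner ℝ (F z) (k z.1) ∂μ.prod (volume.restrict I) := by
  have : IsFiniteMeasure (volume.restrict I) := isFiniteMeasure_restrict.2 hIfin
  have hp₀ : p ≠ 0 := (zero_lt_one.trans_le Fact.out).ne'
  let L : Lp H p μ →L[ℝ] ℝ :=
    (ContinuousLinearMap.lpPairing μ p q (innerSL ℝ)).flip hk.toLp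
  have hL : ∀ a : Lp H p μ, L a = ∫ x, inner ℝ (a x) (k x) ∂μ := fun a => by
    refine (ContinuousLinearMap.lpPairing_eq_integral _ a hk.toLp).trans (integral_congr_ae ?_)
    filter_upwards [hk.coeFn_toLp] with x hx
    rw [hx, innerSL_apply_apply]
  calc ∫ x, inner ℝ ((ρ ⋆ I.indicator (slice p μ F)) t x) (k x) ∂μ
    _ = L (∫ s, ρ (t - s) • I.indicator (slice p μ F) s) := by
        rw [hL, convolution_lsmul_swap]
    _ = ∫ s, L (ρ (t - s) • I.indicator (slice p μ F) s) :=
        (L.integral_comp_comm (hρ.integrable_smul (integrable_indicator_slice hI hIfin hF) t)).symm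
    _ = ∫ s, I.indicator (fun s => ρ (t - s) * L (slice p μ F s)) s := by
        congr with s
        by_cases hs : s ∈ I <;> simp [hs]
    _ = ∫ s in I, ∫ x, ρ (t - s) * inner ℝ (F (x, s)) (k x) ∂μ := by
        rw [integral_indicator hI]
        refine integral_congr_ae ?_
        filter_upwards [ae_memLp_prodMk_right hp₀ hp.out hF] with s hs
        rw [hL, integral_const_mul]
        congr 1
        exact integral_congr_ae ((slice_ae_eq hs).mono fun x hx => by simp only [hx])
    _ = _ := (integral_prod_symm _ (hρ.integrable_comp_sub_mul_inner hF hk t)).symm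

end Slices

section TestFunctions

namespace IsTestFunction

variable {V : Type*} [NormedAddCommGroup V] [NormedSpace ℝ V] {U : Set V} {φ ψ : V → ℝ}

theorem zero (U : Set V) : IsTestFunction U fun _ => (0 : ℝ) where
  contDiff := contDiff_const
  hasCompactSupport := HasCompactSupport.zero
  tsupport_subset := by simp [tsupport]

theorem comp_contDiff (hφ : IsTestFunction U φ) {S : ℝ → ℝ} (hS : ContDiff ℝ ∞ S) (h0 : S 0 = 0) :
    IsTestFunction U fun x => S (φ x) where
  contDiff := hS.comp hφ.contDiff
  hasCompactSupport := hφ.hasCompactSupport.comp_left h0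
  tsupport_subset := (closure_mono (Function.support_comp_subset h0 φ)).trans hφ.tsupport_subset

theorem add (hφ : IsTestFunction U φ) (hψ : IsTestFunction U ψ) :
    IsTestFunction U fun x => φ x + ψ x where
  contDiff := hφ.contDiff.add hψ.contDiff
  hasCompactSupport := hφ.hasCompactSupport.add hψ.hasCompactSupport
  tsupport_subset := (tsupport_add φ ψ).trans
    (union_subset hφ.tsupport_subset hψ.tsupport_subset)

theorem sum {ι : Type*} (s : Finset ι) {φ : ι → V → ℝ} (hφ : ∀ i, IsTestFunction U (φ i)) :
    IsTestFunction U fun x => ∑ i ∈ s, φ i x := by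
  classical
  induction s using Finset.induction_on with
  | empty => simpa only [Finset.sum_empty] using zero U
  | insert i s hi ih => simpa only [Finset.sum_insert hi] using (hφ i).add ih

theorem const_mul (hφ : IsTestFunction U φ) (c : ℝ) : IsTestFunction U fun x => c * φ x :=
  hφ.comp_contDiff (S := fun r => c * r) (by fun_prop) (mul_zero c)

theorem differentiable (hφ : IsTestFunction U φ) : Differentiable ℝ φ :=
  hφ.contDiff.differentiable (by simp)

theorem fderiv_apply (hφ : IsTestFunction U φ) (v : V) :
    IsTestFunction U fun x => fderiv ℝ φ x v where
  contDiff := (hφ.contDiff.fderiv_right (m := ∞) (by simp)).clm_apply contDiff_const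
  hasCompactSupport := (hφ.hasCompactSupport.fderiv ℝ).comp_left (g := fun L : V →L[ℝ] ℝ => L v) rfl
  tsupport_subset := (closure_mono (Function.support_comp_subset
    (g := fun L : V →L[ℝ] ℝ => L v) rfl _)).trans
    ((tsupport_fderiv_subset ℝ).trans hφ.tsupport_subset)

theorem memLp [MeasurableSpace V] [OpensMeasurableSpace V] {μ : Measure V}
    [IsFiniteMeasureOnCompacts μ] (hφ : IsTestFunction U φ) (p : ℝ≥0∞) : MemLp φ p μ :=
  hφ.contDiff.continuous.memLp_of_hasCompactSupport hφ.hasCompactSupport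

theorem setIntegral_mul_eq_integral [MeasurableSpace V] {μ : Measure V} (hφ : IsTestFunction U φ)
    (w : V → ℝ) : ∫ x in U, w x * φ x ∂μ = ∫ x, w x * φ x ∂μ := by
  refine setIntegral_eq_integral_of_forall_compl_eq_zero fun x hx => ?_
  rw [hφ.eq_zero_of_notMem hx, mul_zero]

theorem integral_fderiv_mul_fderiv [MeasurableSpace V] [BorelSpace V] [FiniteDimensional ℝ V]
    {μ : Measure V} [μ.IsAddHaarMeasure] (hφ : IsTestFunction U φ) (hψ : IsTestFunction U ψ)
    (v : V) : ∫ x, fderiv ℝ φ x v * fderiv ℝ ψ x v ∂μ =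
      -∫ x, fderiv ℝ (fun y => fderiv ℝ φ y v) x v * ψ x ∂μ := by
  have hint : ∀ {χ η : V → ℝ}, IsTestFunction U χ → IsTestFunction U η →
      Integrable (fun x => χ x * η x) μ := fun hχ hη =>
    (hχ.contDiff.continuous.mul hη.contDiff.continuous).integrable_of_hasCompactSupport
      hχ.hasCompactSupport.mul_right
  have hφv := hφ.fderiv_apply v
  exact integral_mul_fderiv_eq_neg_fderiv_mul_of_integrable (hint (hφv.fderiv_apply v) hψ)
    (hint hφv (hψ.fderiv_apply v)) (hint hφv hψ) (fun x _ => hφv.differentiable x)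
    (fun x _ => hψ.differentiable x)

variable {H : Type*} [NormedAddCommGroup H] [InnerProductSpace ℝ H] {Ω : Set H} {φ ψ : H → ℝ}

theorem laplacian_eq_sum [FiniteDimensional ℝ H] (hφ : IsTestFunction Ω φ) :
    Δ φ = fun x => ∑ i, fderiv ℝ (fun y => fderiv ℝ φ y (stdOrthonormalBasis ℝ H i)) x
      (stdOrthonormalBasis ℝ H i) := by
  funext x
  rw [InnerProductSpace.laplacian_eq_iteratedFDeriv_stdOrthonormalBasis]
  refine Finset.sum_congr rfl fun i _ => ?_
  have hdiff : DifferentiableAt ℝ (fderiv ℝ φ) x :=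
    (hφ.contDiff.fderiv_right (m := ∞) (by simp)).differentiable (by simp) x
  rw [iteratedFDeriv_two_apply, fderiv_clm_apply hdiff (differentiableAt_const _)]
  simp

theorem laplacian [FiniteDimensional ℝ H] (hφ : IsTestFunction Ω φ) : IsTestFunction Ω (Δ φ) := by
  rw [hφ.laplacian_eq_sum]
  exact sum _ fun i => (hφ.fderiv_apply _).fderiv_apply _

variable [CompleteSpace H]

theorem contDiff_gradient (hφ : IsTestFunction Ω φ) : ContDiff ℝ ∞ (gradient φ) :=
  (InnerProductSpace.toDual ℝ H).symm.contDiff.comp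
    (hφ.contDiff.fderiv_right (m := ∞) (by simp))

theorem hasCompactSupport_gradient (hφ : IsTestFunction Ω φ) : HasCompactSupport (gradient φ) :=
  (hφ.hasCompactSupport.fderiv ℝ).comp_left (map_zero (InnerProductSpace.toDual ℝ H).symm)

theorem memLp_gradient [MeasurableSpace H] [OpensMeasurableSpace H] {μ : Measure H}
    [IsFiniteMeasureOnCompacts μ] (hφ : IsTestFunction Ω φ) (p : ℝ≥0∞) :
    MemLp (gradient φ) p μ :=
  hφ.contDiff_gradient.continuous.memLp_of_hasCompactSupport hφ.hasCompactSupport_gradient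

theorem gradient_eq_zero (hφ : IsTestFunction Ω φ) {x : H} (hx : x ∉ Ω) : gradient φ x = 0 := by
  have : fderiv ℝ φ x = 0 := image_eq_zero_of_notMem_tsupport fun h =>
    hx (hφ.tsupport_subset (tsupport_fderiv_subset ℝ h))
  rw [gradient, this, map_zero]

theorem gradient_comp (hφ : IsTestFunction Ω φ) {S : ℝ → ℝ} (hS : Differentiable ℝ S) (x : H) :
    gradient (fun x => S (φ x)) x = _root_.deriv S (φ x) • gradient φ x := by
  have h := (hS (φ x)).hasDerivAt.comp_hasFDerivAt x (hφ.differentiable x).hasFDerivAt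
  rw [gradient, show fderiv ℝ (fun x => S (φ x)) x = _ from h.fderiv, map_smul, gradient]

theorem gradient_add (hφ : IsTestFunction Ω φ) (hψ : IsTestFunction Ω ψ) (x : H) :
    gradient (fun x => φ x + ψ x) x = gradient φ x + gradient ψ x := by
  simp only [gradient, fderiv_fun_add (hφ.differentiable x) (hψ.differentiable x), map_add]

theorem gradient_const_mul (hφ : IsTestFunction Ω φ) (c : ℝ) (x : H) :
    gradient (fun x => c * φ x) x = c • gradient φ x := by
  simp only [gradient, fderiv_const_mul (hφ.differentiable x), map_smul]

theorem integral_inner_gradient_gradient [FiniteDimensional ℝ H] [MeasurableSpace H] [BorelSpace H]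
    (hφ : IsTestFunction Ω φ) (hψ : IsTestFunction Ω ψ) :
    ∫ x in Ω, inner ℝ (gradient φ x) (gradient ψ x) = -∫ x in Ω, Δ φ x * ψ x := by
  let e := stdOrthonormalBasis ℝ H
  have hint : ∀ {χ η : H → ℝ}, IsTestFunction Ω χ → IsTestFunction Ω η →
      Integrable (fun x => χ x * η x) := fun hχ hη =>
    (hχ.contDiff.continuous.mul hη.contDiff.continuous).integrable_of_hasCompactSupport
      hχ.hasCompactSupport.mul_right
  have hpt : ∀ x, inner ℝ (gradient φ x) (gradient ψ x) =
      ∑ i, fderiv ℝ φ x (e i) * fderiv ℝ ψ x (e i) := fun x => by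
    rw [← e.sum_inner_mul_inner]
    refine Finset.sum_congr rfl fun i _ => ?_
    rw [real_inner_comm (gradient ψ x), inner_gradient_left, inner_gradient_left]
  rw [hψ.setIntegral_mul_eq_integral, setIntegral_eq_integral_of_forall_compl_eq_zero fun x hx => by
    rw [hφ.gradient_eq_zero hx, inner_zero_left]]
  simp only [hpt, hφ.laplacian_eq_sum, Finset.sum_mul]
  rw [integral_finsetSum _ fun i _ => hint (hφ.fderiv_apply _) (hψ.fderiv_apply _),
    integral_finsetSum _ fun i _ => hint ((hφ.fderiv_apply _).fderiv_apply _) hψ,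
    ← Finset.sum_neg_distrib]
  exact Finset.sum_congr rfl fun i _ => hφ.integral_fderiv_mul_fderiv hψ _

end IsTestFunction

variable {V : Type*} [NormedAddCommGroup V] [NormedSpace ℝ V] [FiniteDimensional ℝ V] {U : Set V}

theorem exists_isTestFunction_tendsto (hU : IsOpen U) {g : V → ℝ} (hg : ContDiff ℝ ∞ g)
    (hgc : HasCompactSupport g) : ∃ φ : ℕ → V → ℝ, (∀ k, IsTestFunction U (φ k)) ∧
      (∀ k x, ‖φ k x‖ ≤ ‖g x‖) ∧ ∀ x ∈ U, Tendsto (fun k => φ k x) atTop (𝓝 (g x)) := by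
  obtain ⟨h, hsupp, hh, h01⟩ := hU.exists_contDiff_support_eq (n := ⊤)
  have hcut : ∀ k : ℕ, ContDiff ℝ ∞ fun x => Real.smoothTransition (k * h x - 1) := fun k =>
    Real.smoothTransition.contDiff.comp ((contDiff_const.mul hh).sub contDiff_const)
  refine ⟨fun k x => Real.smoothTransition (k * h x - 1) * g x, fun k =>
    ⟨(hcut k).mul hg, hgc.mul_left, fun x hx => ?_⟩, fun k x => ?_, fun x hx => ?_⟩
  · have hclosed : IsClosed {x | 1 ≤ k * h x} :=
      isClosed_le continuous_const (continuous_const.mul hh.continuous)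
    have hmem : 1 ≤ k * h x := closure_minimal (fun y hy => by
      by_contra hlt
      have hlt' : k * h y < 1 := not_le.1 hlt
      refine hy ?_
      dsimp only
      rw [Real.smoothTransition.zero_of_nonpos (by linarith), zero_mul]) hclosed hx
    rw [← hsupp]
    intro h0
    norm_num [h0] at hmem
  · rw [norm_mul, Real.norm_of_nonneg (Real.smoothTransition.nonneg _)]
    exact mul_le_of_le_one_left (norm_nonneg _) (Real.smoothTransition.le_one _)
  · have hpos : 0 < h x := lt_of_le_of_ne (h01 ⟨x, rfl⟩).1 fun h0 => (hsupp ▸ hx) h0.symm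
    obtain ⟨N, hN⟩ := exists_nat_ge (2 / h x)
    refine tendsto_const_nhds.congr' ?_
    filter_upwards [eventually_ge_atTop N] with k hk
    have : 2 ≤ k * h x := (div_le_iff₀ hpos).1 (hN.trans (by exact_mod_cast hk))
    rw [Real.smoothTransition.one_of_one_le (by linarith), one_mul]

theorem exists_isTestFunction_integral_norm_sub_lt [MeasurableSpace V] [BorelSpace V]
    {μ : Measure V} [IsFiniteMeasureOnCompacts μ] (hU : IsOpen U) {w : V → ℝ}
    (hw : IntegrableOn w U μ) {δ : ℝ} (hδ : 0 < δ) :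
    ∃ φ, IsTestFunction U φ ∧ ∫ x in U, ‖w x - φ x‖ ∂μ < δ := by
  obtain ⟨g, hgc, hg, hwg⟩ := (memLp_one_iff_integrable.2 hw).exist_eLpNorm_sub_le
    ENNReal.one_ne_top le_rfl (half_pos hδ)
  have hgi : IntegrableOn g U μ :=
    (hg.continuous.integrable_of_hasCompactSupport hgc).integrableOn
  obtain ⟨φ, hφ, hφg, hlim⟩ := exists_isTestFunction_tendsto hU hg hgc
  have hφi : ∀ k, IntegrableOn (φ k) U μ := fun k =>
    Integrable.mono hgi (hφ k).contDiff.continuous.aestronglyMeasurable (ae_of_all _ (hφg k))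
  have hconv : Tendsto (fun k => ∫ x in U, ‖g x - φ k x‖ ∂μ) atTop (𝓝 0) := by
    have h := tendsto_integral_of_dominated_convergence (μ := μ.restrict U)
      (F := fun k x => ‖g x - φ k x‖) (f := fun _ => (0 : ℝ)) (fun x => 2 * ‖g x‖)
      (fun k => (hgi.sub (hφi k)).norm.aestronglyMeasurable) (hgi.norm.const_mul 2)
      (fun k => ae_of_all _ fun x => by
        rw [norm_norm, two_mul]
        exact (norm_sub_le _ _).trans (by gcongr; exact hφg k x))
      ((ae_restrict_iff' hU.measurableSet).2 (ae_of_all _ fun x hx => by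
        simpa using ((hlim x hx).const_sub (g x)).norm))
    simpa using h
  obtain ⟨k, hk⟩ := (hconv.eventually_lt_const (half_pos hδ)).exists
  have hwg' : ∫ x in U, ‖w x - g x‖ ∂μ ≤ δ / 2 := by
    change ∫ x in U, ‖(w - g) x‖ ∂μ ≤ δ / 2
    rw [integral_norm_eq_lintegral_enorm (hw.sub hgi).1, ← eLpNorm_one_eq_lintegral_enorm]
    exact ENNReal.toReal_le_of_le_ofReal (half_pos hδ).le hwg
  refine ⟨φ k, hφ k, ?_⟩
  calc ∫ x in U, ‖w x - φ k x‖ ∂μ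
    _ ≤ ∫ x in U, (‖w x - g x‖ + ‖g x - φ k x‖) ∂μ :=
        integral_mono (hw.sub (hφi k)).norm ((hw.sub hgi).norm.add (hgi.sub (hφi k)).norm)
          fun x => norm_sub_le_norm_sub_add_norm_sub _ _ _
    _ = (∫ x in U, ‖w x - g x‖ ∂μ) + ∫ x in U, ‖g x - φ k x‖ ∂μ :=
        integral_add (hw.sub hgi).norm (hgi.sub (hφi k)).norm
    _ < δ := by linarith

end TestFunctions

section Entropy

/-- The smooth convex approximation `√(r² + ε²) - ε` of `|r|`, vanishing at `0`. -/
def smoothAbs (ε r : ℝ) : ℝ := √(r ^ 2 + ε ^ 2) - ε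

variable {ε : ℝ}

theorem smoothAbs_zero (hε : 0 < ε) : smoothAbs ε 0 = 0 := by
  simp [smoothAbs, Real.sqrt_sq hε.le]

theorem contDiff_smoothAbs (hε : 0 < ε) : ContDiff ℝ ∞ (smoothAbs ε) :=
  (ContDiff.sqrt (by fun_prop) fun r => by positivity).sub contDiff_const

theorem smoothAbs_nonneg (ε r : ℝ) : 0 ≤ smoothAbs ε r :=
  sub_nonneg.2 (Real.le_sqrt_of_sq_le (le_add_of_nonneg_left (sq_nonneg r)))

theorem smoothAbs_le_abs (hε : 0 < ε) (r : ℝ) : smoothAbs ε r ≤ |r| := by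
  have : √(r ^ 2 + ε ^ 2) ≤ |r| + ε :=
    Real.sqrt_le_iff.2 ⟨by positivity, by nlinarith [sq_abs r, abs_nonneg r]⟩
  exact sub_le_iff_le_add.2 this

theorem tendsto_smoothAbs (r : ℝ) : Tendsto (fun ε => smoothAbs ε r) (𝓝[>] 0) (𝓝 |r|) := by
  have hcont : Continuous fun ε => smoothAbs ε r := by unfold smoothAbs; fun_prop
  simpa [smoothAbs, Real.sqrt_sq_eq_abs] using (hcont.tendsto 0).mono_left nhdsWithin_le_nhds

theorem hasDerivAt_smoothAbs (hε : 0 < ε) (r : ℝ) :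
    HasDerivAt (smoothAbs ε) (r / √(r ^ 2 + ε ^ 2)) r := by
  have h := ((((hasDerivAt_pow 2 r).add_const (ε ^ 2)).sqrt (by positivity)).sub_const ε)
  refine h.congr_deriv ?_
  simp only [Nat.cast_ofNat, Nat.add_one_sub_one, pow_one]
  field_simp

theorem deriv_smoothAbs (hε : 0 < ε) : deriv (smoothAbs ε) = fun r => r / √(r ^ 2 + ε ^ 2) :=
  funext fun r => (hasDerivAt_smoothAbs hε r).deriv

theorem deriv_smoothAbs_zero (hε : 0 < ε) : deriv (smoothAbs ε) 0 = 0 := by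
  simp [deriv_smoothAbs hε]

theorem contDiff_deriv_smoothAbs (hε : 0 < ε) : ContDiff ℝ ∞ (deriv (smoothAbs ε)) :=
  (contDiff_infty_iff_deriv.1 (contDiff_smoothAbs hε)).2

theorem abs_deriv_smoothAbs_le (hε : 0 < ε) (r : ℝ) : |deriv (smoothAbs ε) r| ≤ 1 := by
  rw [deriv_smoothAbs hε, abs_div, abs_of_nonneg (Real.sqrt_nonneg _)]
  exact div_le_one_of_le₀ (Real.abs_le_sqrt (le_add_of_nonneg_right (sq_nonneg ε)))
    (Real.sqrt_nonneg _)

theorem deriv_deriv_smoothAbs (hε : 0 < ε) (r : ℝ) :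
    deriv (deriv (smoothAbs ε)) r = ε ^ 2 / √(r ^ 2 + ε ^ 2) ^ 3 := by
  have hpos : 0 < r ^ 2 + ε ^ 2 := by positivity
  have hsqrt : 0 < √(r ^ 2 + ε ^ 2) := Real.sqrt_pos.2 hpos
  have hsq : √(r ^ 2 + ε ^ 2) ^ 2 = r ^ 2 + ε ^ 2 := Real.sq_sqrt hpos.le
  have h := (hasDerivAt_id r).div (((hasDerivAt_pow 2 r).add_const (ε ^ 2)).sqrt hpos.ne') hsqrt.ne'
  rw [deriv_smoothAbs hε]
  refine h.deriv.trans ?_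
  simp only [id, Nat.cast_ofNat, Nat.add_one_sub_one, pow_one]
  field_simp
  rw [hsq]
  ring

theorem deriv_deriv_smoothAbs_nonneg (hε : 0 < ε) (r : ℝ) : 0 ≤ deriv (deriv (smoothAbs ε)) r := by
  rw [deriv_deriv_smoothAbs hε]
  positivity

theorem deriv_deriv_smoothAbs_le (hε : 0 < ε) (r : ℝ) :
    deriv (deriv (smoothAbs ε)) r ≤ ε⁻¹ := by
  have : ε ≤ √(r ^ 2 + ε ^ 2) := Real.le_sqrt_of_sq_le (le_add_of_nonneg_left (sq_nonneg r))
  calc deriv (deriv (smoothAbs ε)) r = ε ^ 2 / √(r ^ 2 + ε ^ 2) ^ 3 := deriv_deriv_smoothAbs hε r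
    _ ≤ ε ^ 2 / ε ^ 3 := by gcongr
    _ = ε⁻¹ := by field_simp

theorem convexOn_smoothAbs (hε : 0 < ε) : ConvexOn ℝ univ (smoothAbs ε) :=
  convexOn_univ_of_deriv2_nonneg ((contDiff_smoothAbs hε).differentiable (by simp))
    ((contDiff_deriv_smoothAbs hε).differentiable (by simp)) (deriv_deriv_smoothAbs_nonneg hε)

theorem deriv_smoothAbs_mul_sub_le (hε : 0 < ε) (r s : ℝ) :
    deriv (smoothAbs ε) r * (s - r) ≤ smoothAbs ε s - smoothAbs ε r := by
  have hd : Differentiable ℝ (smoothAbs ε) := (contDiff_smoothAbs hε).differentiable (by simp)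
  rcases lt_trichotomy r s with h | rfl | h
  · have := (convexOn_smoothAbs hε).deriv_le_slope trivial trivial h (hd r)
    rwa [slope_def_field, le_div_iff₀ (sub_pos.2 h)] at this
  · simp
  · have := (convexOn_smoothAbs hε).slope_le_deriv trivial trivial h (hd r)
    rw [slope_def_field, div_le_iff₀ (sub_pos.2 h)] at this
    linarith

variable {X : Type*} [MeasurableSpace X] {μ : Measure X}

/-- The smoothed `L_1` norm `∫ smoothAbs ε (a x) dx`, the entropy which the solutions dissipate. -/
def entropy (ε : ℝ) (a : Lp ℝ 1 μ) : ℝ := ∫ x, smoothAbs ε (a x) ∂μ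

/-- The derivative of `entropy ε` at `a` in the direction `k`. -/
def entropyDeriv (ε : ℝ) (a k : Lp ℝ 1 μ) : ℝ := ∫ x, deriv (smoothAbs ε) (a x) * k x ∂μ

theorem aestronglyMeasurable_deriv_smoothAbs_comp (hε : 0 < ε) (a : Lp ℝ 1 μ) :
    AEStronglyMeasurable (fun x => deriv (smoothAbs ε) (a x)) μ :=
  (contDiff_deriv_smoothAbs hε).continuous.comp_aestronglyMeasurable (Lp.aestronglyMeasurable a)

theorem integrable_smoothAbs_comp (hε : 0 < ε) (a : Lp ℝ 1 μ) :
    Integrable (fun x => smoothAbs ε (a x)) μ :=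
  (L1.integrable_coeFn a).mono
    ((contDiff_smoothAbs hε).continuous.comp_aestronglyMeasurable (Lp.aestronglyMeasurable a))
    (ae_of_all _ fun x => by
      rw [Real.norm_of_nonneg (smoothAbs_nonneg _ _)]
      exact smoothAbs_le_abs hε _)

theorem integrable_deriv_smoothAbs_mul (hε : 0 < ε) (a k : Lp ℝ 1 μ) :
    Integrable (fun x => deriv (smoothAbs ε) (a x) * k x) μ :=
  (L1.integrable_coeFn k).bdd_mul (c := 1) (aestronglyMeasurable_deriv_smoothAbs_comp hε a)
    (ae_of_all _ fun _ => abs_deriv_smoothAbs_le hε _)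

theorem tendsto_entropy (a : Lp ℝ 1 μ) : Tendsto (fun ε => entropy ε a) (𝓝[>] 0) (𝓝 ‖a‖) := by
  rw [L1.norm_eq_integral_norm]
  refine tendsto_integral_filter_of_dominated_convergence (fun x => ‖a x‖) ?_ ?_
    (L1.integrable_coeFn a).norm (ae_of_all _ fun x => tendsto_smoothAbs (a x))
  · filter_upwards [self_mem_nhdsWithin] with ε hε
    exact (integrable_smoothAbs_comp hε a).1
  · filter_upwards [self_mem_nhdsWithin] with ε hε
    refine ae_of_all _ fun x => ?_
    rw [Real.norm_of_nonneg (smoothAbs_nonneg _ _)]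
    exact smoothAbs_le_abs hε _

theorem entropyDeriv_congr {a k : Lp ℝ 1 μ} {a' k' : X → ℝ} (ha : a =ᵐ[μ] a') (hk : k =ᵐ[μ] k') :
    entropyDeriv ε a k = ∫ x, deriv (smoothAbs ε) (a' x) * k' x ∂μ := by
  refine integral_congr_ae ?_
  filter_upwards [ha, hk] with x hax hkx
  rw [hax, hkx]

theorem entropyDeriv_sub (hε : 0 < ε) (a k l : Lp ℝ 1 μ) :
    entropyDeriv ε a (k - l) = entropyDeriv ε a k - entropyDeriv ε a l := by
  rw [entropyDeriv, entropyDeriv, entropyDeriv, ← integral_sub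
    (integrable_deriv_smoothAbs_mul hε a k) (integrable_deriv_smoothAbs_mul hε a l)]
  refine integral_congr_ae ?_
  filter_upwards [Lp.coeFn_sub k l] with x hx
  rw [hx, Pi.sub_apply, mul_sub]

theorem entropyDeriv_smul (a k : Lp ℝ 1 μ) (c : ℝ) :
    entropyDeriv ε a (c • k) = c * entropyDeriv ε a k := by
  rw [entropyDeriv, entropyDeriv, ← integral_const_mul]
  refine integral_congr_ae ?_
  filter_upwards [Lp.coeFn_smul c k] with x hx
  rw [hx, Pi.smul_apply, smul_eq_mul, mul_left_comm]

theorem abs_entropyDeriv_le (hε : 0 < ε) (a k : Lp ℝ 1 μ) : |entropyDeriv ε a k| ≤ ‖k‖ := by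
  rw [L1.norm_eq_integral_norm, ← Real.norm_eq_abs]
  refine norm_integral_le_of_norm_le (L1.integrable_coeFn k).norm (ae_of_all _ fun x => ?_)
  rw [norm_mul]
  exact mul_le_of_le_one_left (norm_nonneg _) (abs_deriv_smoothAbs_le hε _)

theorem abs_entropyDeriv_sub_le (hε : 0 < ε) (a k l : Lp ℝ 1 μ) :
    |entropyDeriv ε a k - entropyDeriv ε a l| ≤ ‖k - l‖ :=
  (entropyDeriv_sub hε a k l).symm ▸ abs_entropyDeriv_le hε a (k - l)

theorem continuous_entropyDeriv_left (hε : 0 < ε) (k : Lp ℝ 1 μ) :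
    Continuous fun a => entropyDeriv ε a k := by
  refine continuous_iff_seqContinuous.2 fun a a₀ ha => tendsto_of_subseq_tendsto fun ns hns => ?_
  obtain ⟨ms, -, hms⟩ := (tendstoInMeasure_of_tendsto_Lp (ha.comp hns)).exists_seq_tendsto_ae
  refine ⟨ms, tendsto_integral_of_dominated_convergence (fun x => ‖k x‖)
    (fun j => (integrable_deriv_smoothAbs_mul hε _ k).1) (L1.integrable_coeFn k).norm
    (fun j => ae_of_all _ fun x => ?_) ?_⟩
  · rw [norm_mul]
    exact mul_le_of_le_one_left (norm_nonneg _) (abs_deriv_smoothAbs_le hε _)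
  · filter_upwards [hms] with x hx
    exact (((contDiff_deriv_smoothAbs hε).continuous.tendsto _).comp hx).mul_const _

theorem continuous_entropyDeriv (hε : 0 < ε) :
    Continuous fun y : Lp ℝ 1 μ × Lp ℝ 1 μ => entropyDeriv ε y.1 y.2 :=
  continuous_prod_of_continuous_lipschitzWith' _ 1 (fun a => LipschitzWith.mk_one fun k l => by
    rw [Real.dist_eq, dist_eq_norm]
    exact abs_entropyDeriv_sub_le hε a k l) (continuous_entropyDeriv_left hε)

theorem entropyDeriv_sub_le (hε : 0 < ε) (a b : Lp ℝ 1 μ) :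
    entropyDeriv ε a (b - a) ≤ entropy ε b - entropy ε a := by
  rw [entropy, entropy, ← integral_sub (integrable_smoothAbs_comp hε b)
    (integrable_smoothAbs_comp hε a)]
  refine integral_mono_ae (integrable_deriv_smoothAbs_mul hε a _)
    ((integrable_smoothAbs_comp hε b).sub (integrable_smoothAbs_comp hε a)) ?_
  filter_upwards [Lp.coeFn_sub b a] with x hx
  rw [hx]
  exact deriv_smoothAbs_mul_sub_le hε _ _

theorem le_entropyDeriv_sub (hε : 0 < ε) (a b : Lp ℝ 1 μ) :
    entropy ε b - entropy ε a ≤ entropyDeriv ε b (b - a) := by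
  have h := entropyDeriv_sub_le hε b a
  rw [← neg_sub b a, ← neg_one_smul ℝ, entropyDeriv_smul] at h
  linarith

theorem abs_entropy_sub_le (hε : 0 < ε) (a b : Lp ℝ 1 μ) :
    |entropy ε a - entropy ε b| ≤ ‖a - b‖ := by
  have hb := abs_le.1 (abs_entropyDeriv_le hε b (a - b))
  have ha := abs_le.1 (abs_entropyDeriv_le hε a (a - b))
  exact abs_le.2 ⟨hb.1.trans (entropyDeriv_sub_le hε b a), (le_entropyDeriv_sub hε b a).trans ha.2⟩

theorem continuous_entropy (hε : 0 < ε) : Continuous (entropy ε : Lp ℝ 1 μ → ℝ) :=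
  (LipschitzWith.mk_one fun a b => by
    rw [Real.dist_eq, dist_eq_norm]
    exact abs_entropy_sub_le hε a b).continuous

/- Convexity traps the difference quotient between the derivatives at the two end points; the
entropy is not Fréchet differentiable, but its derivative is jointly continuous. -/
theorem hasDerivAt_entropy_comp (hε : 0 < ε) {w : ℝ → Lp ℝ 1 μ} {w' : Lp ℝ 1 μ} {t : ℝ}
    (hw : HasDerivAt w w' t) :
    HasDerivAt (fun s => entropy ε (w s)) (entropyDeriv ε (w t) w') t := by
  rw [hasDerivAt_iff_tendsto_slope]
  have hcont := (continuous_entropyDeriv (μ := μ) hε).tendsto (w t, w')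
  have hslope := hw.tendsto_slope
  have hleft : Tendsto (fun s => entropyDeriv ε (w t) (slope w t s)) (𝓝[≠] t)
      (𝓝 (entropyDeriv ε (w t) w')) := hcont.comp (tendsto_const_nhds.prodMk_nhds hslope)
  have hright : Tendsto (fun s => entropyDeriv ε (w s) (slope w t s)) (𝓝[≠] t)
      (𝓝 (entropyDeriv ε (w t) w')) := hcont.comp
    ((hw.continuousAt.tendsto.mono_left nhdsWithin_le_nhds).prodMk_nhds hslope)
  have hbound : ∀ s, entropyDeriv ε (w t) (slope w t s) ⊓ entropyDeriv ε (w s) (slope w t s) ≤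
      slope (fun s => entropy ε (w s)) t s ∧ slope (fun s => entropy ε (w s)) t s ≤
      entropyDeriv ε (w t) (slope w t s) ⊔ entropyDeriv ε (w s) (slope w t s) := fun s => by
    have hlo := entropyDeriv_sub_le hε (w t) (w s)
    have hhi := le_entropyDeriv_sub hε (w t) (w s)
    simp only [slope_def_module, entropyDeriv_smul, smul_eq_mul]
    rcases le_total 0 (s - t)⁻¹ with h | h
    · exact ⟨inf_le_left.trans (mul_le_mul_of_nonneg_left hlo h),
        (mul_le_mul_of_nonneg_left hhi h).trans le_sup_right⟩
    · exact ⟨inf_le_right.trans (mul_le_mul_of_nonpos_left hhi h),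
        (mul_le_mul_of_nonpos_left hlo h).trans le_sup_left⟩
  exact tendsto_of_tendsto_of_tendsto_of_le_of_le (by simpa using hleft.inf_nhds hright)
    (by simpa using hleft.sup_nhds hright) (fun s => (hbound s).1) fun s => (hbound s).2

end Entropy

section Stationary

theorem integral_norm_mul_norm_le {X V : Type*} [MeasurableSpace X] [NormedAddCommGroup V]
    {μ : Measure X} (F K : Lp V 2 μ) : ∫ x, ‖F x‖ * ‖K x‖ ∂μ ≤ ‖F‖ * ‖K‖ := by
  have hF := (Lp.memLp F).norm
  have hK := (Lp.memLp K).norm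
  have hnorm : ∀ A : Lp V 2 μ, ‖(Lp.memLp A).norm.toLp‖ = ‖A‖ := fun A => by
    rw [Lp.norm_toLp, eLpNorm_norm, Lp.norm_def]
  calc ∫ x, ‖F x‖ * ‖K x‖ ∂μ
    _ = inner ℝ hF.toLp hK.toLp := by
        rw [L2.inner_def]
        refine integral_congr_ae ?_
        filter_upwards [hF.coeFn_toLp, hK.coeFn_toLp] with x hFx hKx
        rw [hFx, hKx, RCLike.inner_apply, conj_trivial, mul_comm]
    _ ≤ ‖hF.toLp‖ * ‖hK.toLp‖ := real_inner_le_norm _ _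
    _ = ‖F‖ * ‖K‖ := by rw [hnorm, hnorm]

variable {H : Type*} [NormedAddCommGroup H] [InnerProductSpace ℝ H] [FiniteDimensional ℝ H]
  [MeasurableSpace H] [BorelSpace H] {Ω : Set H} {ε : ℝ}

/-- The graph of the gradient on test functions. Its closure in `L_1 × L_2` consists of the pairs
`(v, ∇v)`, where `v` vanishes on the boundary in the sense of `W̊^1_2`. -/
def testGraph (Ω : Set H) :
    Submodule ℝ (Lp ℝ 1 (volume.restrict Ω) × Lp H 2 (volume.restrict Ω)) where
  carrier := {y | ∃ φ, IsTestFunction Ω φ ∧ y.1 =ᵐ[volume.restrict Ω] φ ∧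
    y.2 =ᵐ[volume.restrict Ω] gradient φ}
  zero_mem' := by
    refine ⟨_, IsTestFunction.zero Ω, Lp.coeFn_zero .., (Lp.coeFn_zero ..).trans ?_⟩
    exact ae_of_all _ fun x => (gradient_fun_const x (0 : ℝ)).symm
  add_mem' := by
    rintro y z ⟨φ, hφ, hy, hy'⟩ ⟨ψ, hψ, hz, hz'⟩
    refine ⟨_, hφ.add hψ, (Lp.coeFn_add _ _).trans (hy.add hz), ?_⟩
    filter_upwards [Lp.coeFn_add y.2 z.2, hy', hz'] with x hx hyx hzx
    rw [hφ.gradient_add hψ, Prod.snd_add, hx, Pi.add_apply, hyx, hzx]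
  smul_mem' := by
    rintro c y ⟨φ, hφ, hy, hy'⟩
    refine ⟨_, hφ.const_mul c, (Lp.coeFn_smul _ _).trans (hy.const_smul c), ?_⟩
    filter_upwards [Lp.coeFn_smul c y.2, hy'] with x hx hyx
    rw [hφ.gradient_const_mul, Prod.smul_snd, hx, Pi.smul_apply, hyx]

/-- `div F = R` in the sense of distributions on `Ω`. -/
def HasWeakDivergence (Ω : Set H) (F : H → H) (R : H → ℝ) : Prop :=
  ∀ ψ, IsTestFunction Ω ψ → ∫ x in Ω, inner ℝ (F x) (gradient ψ x) = -∫ x in Ω, R x * ψ x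

/-- `div B ≤ 0` in the sense of distributions on `Ω`. -/
def WeakDivergenceNonpos (Ω : Set H) (B : H → H) : Prop :=
  ∀ ψ, IsTestFunction Ω ψ → (∀ x, 0 ≤ ψ x) → 0 ≤ ∫ x in Ω, inner ℝ (B x) (gradient ψ x)

theorem IsTestFunction.integral_deriv_smoothAbs_mul_eq {φ : H → ℝ} (hε : 0 < ε) {F : H → H}
    {R : H → ℝ} (hφ : IsTestFunction Ω φ) (hdiv : HasWeakDivergence Ω F R) :
    ∫ x in Ω, _root_.deriv (smoothAbs ε) (φ x) * R x =
      ∫ x in Ω, _root_.deriv (_root_.deriv (smoothAbs ε)) (φ x) *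
        -inner ℝ (F x) (gradient φ x) := by
  have h := hdiv _ (hφ.comp_contDiff (contDiff_deriv_smoothAbs hε) (deriv_smoothAbs_zero hε))
  simp only [hφ.gradient_comp ((contDiff_deriv_smoothAbs hε).differentiable (by simp)),
    inner_smul_right] at h
  simp only [mul_neg, integral_neg, h, neg_neg, mul_comm (R _)]

theorem integral_deriv_deriv_smoothAbs_mul_neg_inner_le {φ : H → ℝ} (hε : 0 < ε)
    (hφ : Continuous φ) (G A : Lp H 2 (volume.restrict Ω)) :
    ∫ x in Ω, deriv (deriv (smoothAbs ε)) (φ x) * -inner ℝ (G x) (A x) ≤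
      ε⁻¹ * (‖G‖ * ‖G - A‖) := by
  have hnonneg := deriv_deriv_smoothAbs_nonneg hε
  have hle := deriv_deriv_smoothAbs_le hε
  have hcont : Continuous fun x => deriv (deriv (smoothAbs ε)) (φ x) :=
    ((contDiff_deriv_smoothAbs hε).continuous_deriv (by simp)).comp hφ
  have hint : Integrable (fun x => ‖G x‖ * ‖(G - A) x‖) (volume.restrict Ω) :=
    (Lp.memLp G).norm.integrable_mul (Lp.memLp (G - A)).norm
  calc ∫ x in Ω, deriv (deriv (smoothAbs ε)) (φ x) * -inner ℝ (G x) (A x)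
    _ ≤ ∫ x in Ω, ε⁻¹ * (‖G x‖ * ‖(G - A) x‖) := by
        refine integral_mono_ae ((L2.integrable_inner (𝕜 := ℝ) G A).neg.bdd_mul (c := ε⁻¹)
          hcont.aestronglyMeasurable ?_) (hint.const_mul _) ?_
        · exact ae_of_all _ fun x => (abs_of_nonneg (hnonneg (φ x))).trans_le (hle (φ x))
        · filter_upwards [Lp.coeFn_sub G A] with x hsub
          have hinner : -inner ℝ (G x) (A x) ≤ ‖G x‖ * ‖(G - A) x‖ := by
            rw [hsub, Pi.sub_apply]
            refine le_trans ?_ (real_inner_le_norm (G x) (G x - A x))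
            rw [inner_sub_right]
            linarith [real_inner_self_nonneg (x := G x)]
          exact (mul_le_mul_of_nonneg_left hinner (hnonneg _)).trans
            (mul_le_mul_of_nonneg_right (hle _) (by positivity))
    _ = ε⁻¹ * ∫ x in Ω, ‖G x‖ * ‖(G - A) x‖ := integral_const_mul _ _
    _ ≤ ε⁻¹ * (‖G‖ * ‖G - A‖) := by gcongr; exact integral_norm_mul_norm_le _ _

theorem entropyDeriv_le_of_mem_testGraph (hε : 0 < ε) {ν : ℝ} (hν : 0 ≤ ν)
    {y : Lp ℝ 1 (volume.restrict Ω) × Lp H 2 (volume.restrict Ω)} (hy : y ∈ testGraph Ω)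
    {G : Lp H 2 (volume.restrict Ω)} {R : Lp ℝ 1 (volume.restrict Ω)}
    (hdiv : HasWeakDivergence Ω (fun x => ν • G x) R) :
    entropyDeriv ε y.1 R ≤ ν * (ε⁻¹ * (‖G‖ * ‖G - y.2‖)) := by
  obtain ⟨φ, hφ, hy₁, hy₂⟩ := hy
  calc entropyDeriv ε y.1 R
    _ = ∫ x in Ω, deriv (deriv (smoothAbs ε)) (φ x) * -inner ℝ (ν • G x) (gradient φ x) := by
        rw [entropyDeriv_congr hy₁ (ae_eq_refl R), hφ.integral_deriv_smoothAbs_mul_eq hε hdiv]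
    _ = ∫ x in Ω, ν * (deriv (deriv (smoothAbs ε)) (φ x) * -inner ℝ (G x) (y.2 x)) := by
        refine integral_congr_ae ?_
        filter_upwards [hy₂] with x hx
        rw [hx, real_inner_smul_left, ← mul_neg, mul_left_comm]
    _ = ν * ∫ x in Ω, deriv (deriv (smoothAbs ε)) (φ x) * -inner ℝ (G x) (y.2 x) :=
        integral_const_mul _ _
    _ ≤ ν * (ε⁻¹ * (‖G‖ * ‖G - y.2‖)) := by
        gcongr
        exact integral_deriv_deriv_smoothAbs_mul_neg_inner_le hε hφ.contDiff.continuous G y.2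

/- On the graph, the test function `S_ε'(φ)` gives `-ν ∫ S_ε''(φ) ⟨G, ∇φ⟩`, which is nonpositive up
to the distance of `∇φ` from `G`. -/
theorem entropyDeriv_nonpos_of_hasWeakDivergence (hε : 0 < ε) {ν : ℝ} (hν : 0 ≤ ν)
    {R Z : Lp ℝ 1 (volume.restrict Ω)} {G : Lp H 2 (volume.restrict Ω)}
    (hZ : (Z, G) ∈ (testGraph Ω).topologicalClosure)
    (hdiv : HasWeakDivergence Ω (fun x => ν • G x) R) : entropyDeriv ε Z R ≤ 0 := by
  have hclosed : IsClosed {y : Lp ℝ 1 (volume.restrict Ω) × Lp H 2 (volume.restrict Ω) |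
      entropyDeriv ε y.1 R ≤ ν * (ε⁻¹ * (‖G‖ * ‖G - y.2‖))} :=
    isClosed_le ((continuous_entropyDeriv_left hε R).comp continuous_fst) (by fun_prop)
  have hle : entropyDeriv ε Z R ≤ ν * (ε⁻¹ * (‖G‖ * ‖G - G‖)) :=
    closure_minimal (fun y hy => entropyDeriv_le_of_mem_testGraph hε hν hy hdiv) hclosed hZ
  simpa using hle

theorem IsTestFunction.integral_deriv_smoothAbs_mul_inner_nonneg {φ : H → ℝ} (hε : 0 < ε)
    {B : H → H} (hφ : IsTestFunction Ω φ)
    (hB : WeakDivergenceNonpos Ω B) :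
    0 ≤ ∫ x in Ω, _root_.deriv (smoothAbs ε) (φ x) * inner ℝ (B x) (gradient φ x) := by
  have h := hB _ (hφ.comp_contDiff (contDiff_smoothAbs hε) (smoothAbs_zero hε))
    fun x => smoothAbs_nonneg ε (φ x)
  simpa only [hφ.gradient_comp ((contDiff_smoothAbs hε).differentiable (by simp)),
    inner_smul_right] using h

theorem entropyDeriv_inner_nonneg (hε : 0 < ε) {B : Lp H 2 (volume.restrict Ω)}
    (hB : WeakDivergenceNonpos Ω B)
    {K Z : Lp ℝ 1 (volume.restrict Ω)} {G : Lp H 2 (volume.restrict Ω)}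
    (hZ : (Z, G) ∈ (testGraph Ω).topologicalClosure)
    (hK : K =ᵐ[volume.restrict Ω] fun x => inner ℝ (B x) (G x)) : 0 ≤ entropyDeriv ε Z K := by
  let innerB : Lp H 2 (volume.restrict Ω) →L[ℝ] Lp ℝ 1 (volume.restrict Ω) :=
    (innerSL ℝ).holderL (volume.restrict Ω) 2 2 1 B
  have hinnerB : ∀ A, innerB A =ᵐ[volume.restrict Ω] fun x => inner ℝ (B x) (A x) := fun A => by
    filter_upwards [ContinuousLinearMap.coeFn_holder (r := 1) (innerSL ℝ) B A] with x hx
    exact hx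
  have hclosed : IsClosed {y : Lp ℝ 1 (volume.restrict Ω) × Lp H 2 (volume.restrict Ω) |
      0 ≤ entropyDeriv ε y.1 (innerB y.2)} :=
    isClosed_le continuous_const ((continuous_entropyDeriv hε).comp
      (continuous_fst.prodMk (innerB.continuous.comp continuous_snd)))
  have hgraph : ∀ y ∈ testGraph Ω, 0 ≤ entropyDeriv ε y.1 (innerB y.2) := by
    rintro y ⟨φ, hφ, hy₁, hy₂⟩
    have hy : innerB y.2 =ᵐ[volume.restrict Ω] fun x => inner ℝ (B x) (gradient φ x) := by
      filter_upwards [hinnerB y.2, hy₂] with x hx hφx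
      rw [hx, hφx]
    rw [entropyDeriv_congr hy₁ hy]
    exact hφ.integral_deriv_smoothAbs_mul_inner_nonneg hε hB
  have hKG : K = innerB G := Lp.ext (hK.trans (hinnerB G).symm)
  rw [hKG]
  exact closure_minimal hgraph hclosed hZ

end Stationary

section SpaceTime

theorem IsTestFunction.prod_mul_comp_sub {V : Type*} [NormedAddCommGroup V] [NormedSpace ℝ V]
    {U : Set V} {ψ : V → ℝ} (hψ : IsTestFunction U ψ) {I J : Set ℝ} {ρ : ℝ → ℝ}
    (hρ : IsTestFunction J ρ) {t : ℝ} (hJI : (fun s => t - s) ⁻¹' J ⊆ I) :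
    IsTestFunction (U ×ˢ I) fun z => ρ (t - z.2) * ψ z.1 := by
  have hsub : tsupport (fun z : V × ℝ => ρ (t - z.2) * ψ z.1) ⊆
      tsupport ψ ×ˢ ((fun s => t - s) ⁻¹' tsupport ρ) := by
    refine closure_minimal (fun z hz => ?_) ((isClosed_tsupport ψ).prod
      ((isClosed_tsupport ρ).preimage (continuous_sub_left t)))
    exact ⟨subset_tsupport ψ (right_ne_zero_of_mul hz), subset_tsupport ρ (left_ne_zero_of_mul hz)⟩
  refine ⟨?_, ?_, hsub.trans (prod_mono hψ.tsupport_subset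
    ((preimage_mono hρ.tsupport_subset).trans hJI))⟩
  · exact (hρ.contDiff.comp (contDiff_const.sub contDiff_snd)).mul (hψ.contDiff.comp contDiff_fst)
  · exact (IsCompact.prod hψ.hasCompactSupport ((Homeomorph.subLeft t).isCompact_preimage.2
      hρ.hasCompactSupport)).of_isClosed_subset (isClosed_tsupport _) hsub

variable {n : ℕ} {Ω : Set (E n)} {T : ℝ}

theorem gradX_mul_comp_sub {ψ : E n → ℝ} (hψ : IsTestFunction Ω ψ) (ρ : ℝ → ℝ) (t : ℝ)
    (z : E n × ℝ) :
    gradX (fun z => ρ (t - z.2) * ψ z.1) z = ρ (t - z.2) • gradient ψ z.1 :=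
  hψ.gradient_const_mul (ρ (t - z.2)) z.1

theorem derivT_mul_comp_sub {ρ : ℝ → ℝ} (hρ : Differentiable ℝ ρ) (ψ : E n → ℝ) (t : ℝ)
    (z : E n × ℝ) :
    derivT (fun z => ρ (t - z.2) * ψ z.1) z = -(deriv ρ (t - z.2) * ψ z.1) := by
  have h := ((hρ (t - z.2)).hasDerivAt.comp_const_sub t z.2).mul_const (ψ z.1)
  rw [derivT, ← neg_mul]
  exact h.deriv

theorem volume_restrict_cylinder (Ω : Set (E n)) (T : ℝ) :
    volume.restrict (cylinder Ω T) = (volume.restrict Ω).prod (volume.restrict (Ioo 0 T)) := by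
  rw [cylinder, Measure.volume_eq_prod, Measure.prod_restrict]

theorem isClosed_weakDivergenceNonpos {H : Type*} [NormedAddCommGroup H] [InnerProductSpace ℝ H]
    [FiniteDimensional ℝ H] [MeasurableSpace H] [BorelSpace H] (Ω : Set H) :
    IsClosed {B : Lp H 2 (volume.restrict Ω) | WeakDivergenceNonpos Ω B} := by
  simp only [WeakDivergenceNonpos, ofPred_forall]
  refine isClosed_iInter fun ψ => isClosed_iInter fun hψ => isClosed_iInter fun _ => ?_
  have hgrad : MemLp (gradient ψ) 2 (volume.restrict Ω) := hψ.memLp_gradient 2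
  have hval : ∀ B : Lp H 2 (volume.restrict Ω),
      inner ℝ B hgrad.toLp = ∫ x in Ω, inner ℝ (B x) (gradient ψ x) := fun B => by
    rw [L2.inner_def]
    refine integral_congr_ae ?_
    filter_upwards [hgrad.coeFn_toLp] with x hx
    rw [hx]
  simp only [← hval]
  exact isClosed_le continuous_const (continuous_id.inner continuous_const)

/-- The time slices of a function on the cylinder `Q_T`, extended by `0` to all times. -/
abbrev cylinderSlice {V : Type*} [NormedAddCommGroup V] (Ω : Set (E n)) (T : ℝ) (p : ℝ≥0∞)
    (F : E n × ℝ → V) : ℝ → Lp V p (volume.restrict Ω) :=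
  (Ioo 0 T).indicator (slice p (volume.restrict Ω) F)

theorem DivNonpos.weakDivergenceNonpos_convolution {b : E n × ℝ → E n} (hdiv : DivNonpos Ω T b)
    (hb : MemLp b 2 (volume.restrict (cylinder Ω T))) {t : ℝ} (ht : t < T) {ρ : ℝ → ℝ}
    (hρ : IsTestFunction (Ioo 0 t) ρ) (hρ₀ : ∀ s, 0 ≤ ρ s) :
    WeakDivergenceNonpos Ω ((ρ ⋆ cylinderSlice Ω T 2 b) t) := by
  have : Fact ((2 : ℝ≥0∞) ≠ ⊤) := ⟨ENNReal.ofNat_ne_top⟩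
  intro ψ hψ hψ₀
  have h := hdiv _ (hψ.prod_mul_comp_sub hρ (t := t) fun s hs =>
    ⟨by linarith [hs.2], by linarith [hs.1]⟩) fun z => mul_nonneg (hρ₀ _) (hψ₀ _)
  rw [volume_restrict_cylinder] at hb h
  rw [integral_inner_convolution_indicator_slice measurableSet_Ioo measure_Ioo_lt_top.ne hb
    (hψ.memLp_gradient 2) hρ]
  simpa only [gradX_mul_comp_sub hψ, inner_smul_right] using h

theorem DivNonpos.ae_weakDivergenceNonpos_slice {b : E n × ℝ → E n} (hdiv : DivNonpos Ω T b)
    (hb : MemLp b 2 (volume.restrict (cylinder Ω T))) :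
    ∀ᵐ s ∂(volume.restrict (Ioo 0 T)),
      WeakDivergenceNonpos Ω (slice 2 (volume.restrict Ω) b s) := by
  have : Fact ((2 : ℝ≥0∞) ≠ ⊤) := ⟨ENNReal.ofNat_ne_top⟩
  obtain ⟨ns, hns, hlim⟩ := exists_seq_tendsto_ae_convolution_timeKernel
    (integrable_indicator_slice measurableSet_Ioo measure_Ioo_lt_top.ne
      (volume_restrict_cylinder Ω T ▸ hb))
  filter_upwards [ae_restrict_of_ae hlim, ae_restrict_mem measurableSet_Ioo] with t ht htT
  rw [indicator_of_mem htT] at ht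
  refine (isClosed_weakDivergenceNonpos Ω).mem_of_tendsto ht ?_
  filter_upwards [hns.tendsto_atTop.eventually (eventually_isTestFunction_timeKernel htT.1)]
    with k hk
  exact hdiv.weakDivergenceNonpos_convolution hb htT.2 hk (timeKernel_nonneg _)

theorem MemW12Zero.mem_topologicalClosure_testGraph [IsFiniteMeasure (volume.restrict Ω)]
    {v : E n → ℝ} {g : E n → E n} (h : MemW12Zero Ω v g) {Z : Lp ℝ 1 (volume.restrict Ω)}
    {G : Lp (E n) 2 (volume.restrict Ω)} (hZ : Z =ᵐ[volume.restrict Ω] v)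
    (hG : G =ᵐ[volume.restrict Ω] g) : (Z, G) ∈ (testGraph Ω).topologicalClosure := by
  obtain ⟨φ, hφ, hv, hg⟩ := h.mem_closure
  replace hv : Tendsto (fun k => eLpNorm (φ k - v) 2 (volume.restrict Ω)) atTop (𝓝 0) := hv
  have hv₁ : MemLp v 1 (volume.restrict Ω) := h.memW12.memLp.mono_exponent one_le_two
  have hφ₁ : ∀ k, MemLp (φ k) 1 (volume.restrict Ω) := fun k => (hφ k).memLp 1
  have hφ₂ : ∀ k, MemLp (gradient (φ k)) 2 (volume.restrict Ω) := fun k => (hφ k).memLp_gradient 2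
  obtain rfl : Z = hv₁.toLp := Lp.ext (hZ.trans hv₁.coeFn_toLp.symm)
  obtain rfl : G = h.memW12.memLp_grad.toLp :=
    Lp.ext (hG.trans h.memW12.memLp_grad.coeFn_toLp.symm)
  refine mem_closure_of_tendsto (b := atTop) (Tendsto.prodMk_nhds
    ((Lp.tendsto_Lp_iff_tendsto_eLpNorm'' φ hφ₁ v hv₁).2 ?_)
    ((Lp.tendsto_Lp_iff_tendsto_eLpNorm'' _ hφ₂ _ _).2 hg))
    (.of_forall fun k => ⟨φ k, hφ k, (hφ₁ k).coeFn_toLp, (hφ₂ k).coeFn_toLp⟩)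
  refine tendsto_of_tendsto_of_tendsto_of_le_of_le tendsto_const_nhds ?_ (fun _ => zero_le)
    fun k => eLpNorm_le_eLpNorm_mul_rpow_measure_univ one_le_two ((hφ₁ k).sub hv₁).1
  simpa only [zero_mul] using ENNReal.Tendsto.mul_const hv (.inr (ENNReal.rpow_ne_top_of_nonneg
    (by norm_num) (measure_ne_top (volume.restrict Ω) univ)))

end SpaceTime

section HeatSolution

theorem IsTestFunction.sub {V : Type*} [NormedAddCommGroup V] [NormedSpace ℝ V] {U : Set V}
    {φ ψ : V → ℝ} (hφ : IsTestFunction U φ) (hψ : IsTestFunction U ψ) :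
    IsTestFunction U fun x => φ x - ψ x := by
  simpa only [neg_one_mul, ← sub_eq_add_neg] using hφ.add (hψ.const_mul (-1))

theorem convolution_indicator_const {V : Type*} [NormedAddCommGroup V] [NormedSpace ℝ V]
    [CompleteSpace V] {ρ : ℝ → ℝ} (hρ : IsTestFunction (Ioi 0) ρ) {T t : ℝ} (hT : 0 ≤ T)
    (ht : t ≤ T) (a : V) :
    (ρ ⋆ (Ioo 0 T).indicator fun _ => a) t = (∫ s in 0..t, ρ s) • a := by
  have hpast : ∫ s in (t - T)..0, ρ s = 0 := by
    rw [intervalIntegral.integral_of_le (by linarith)]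
    exact setIntegral_eq_zero_of_forall_eq_zero fun s hs => hρ.eq_zero_of_notMem (notMem_Ioi.2 hs.2)
  calc (ρ ⋆ (Ioo 0 T).indicator fun _ => a) t
    _ = ∫ s in Ioo 0 T, ρ (t - s) • a := by
        rw [convolution_lsmul_swap, ← integral_indicator measurableSet_Ioo]
        exact integral_congr_ae (ae_of_all _ fun s => by
          by_cases hs : s ∈ Ioo 0 T <;> simp [hs])
    _ = (∫ s in 0..T, ρ (t - s)) • a := by
        rw [integral_smul_const, intervalIntegral.integral_of_le hT, integral_Ioc_eq_integral_Ioo]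
    _ = (∫ s in 0..t, ρ s) • a := by
        rw [intervalIntegral.integral_comp_sub_left ρ t, sub_zero,
          ← intervalIntegral.integral_add_adjacent_intervals (b := 0)
            hρ.integrable.intervalIntegrable hρ.integrable.intervalIntegrable, hpast, zero_add]

variable {H : Type*} [NormedAddCommGroup H] [InnerProductSpace ℝ H] [FiniteDimensional ℝ H]
  [MeasurableSpace H] [BorelSpace H] {Ω : Set H} {T ν : ℝ}

theorem IsTestFunction.integrable_lp_mul {V : Type*} [NormedAddCommGroup V] [NormedSpace ℝ V]
    [MeasurableSpace V] [OpensMeasurableSpace V] {μ : Measure V} [IsFiniteMeasureOnCompacts μ]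
    {U : Set V} {ψ : V → ℝ} (hψ : IsTestFunction U ψ) (a : Lp ℝ 1 μ) :
    Integrable (fun x => a x * ψ x) μ :=
  (L1.integrable_coeFn a).mul_of_top_left (hψ.memLp ⊤)

theorem HasWeakDivergence.sub {G G' : Lp H 2 (volume.restrict Ω)}
    {R R' : Lp ℝ 1 (volume.restrict Ω)} (h : HasWeakDivergence Ω (fun x => ν • G x) R)
    (h' : HasWeakDivergence Ω (fun x => ν • G' x) R') :
    HasWeakDivergence Ω (fun x => ν • (G - G') x) (R - R' : Lp ℝ 1 (volume.restrict Ω)) := by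
  intro ψ hψ
  have hint : ∀ A : Lp H 2 (volume.restrict Ω),
      Integrable (fun x => inner ℝ (ν • A x) (gradient ψ x)) (volume.restrict Ω) := fun A =>
    memLp_one_iff_integrable.1 ((innerSL ℝ).memLp_of_bilin 1 ((Lp.memLp A).const_smul ν)
      (hψ.memLp_gradient 2))
  calc ∫ x in Ω, inner ℝ (ν • (G - G') x) (gradient ψ x)
    _ = ∫ x in Ω, (inner ℝ (ν • G x) (gradient ψ x) - inner ℝ (ν • G' x) (gradient ψ x)) := by
        refine integral_congr_ae ?_
        filter_upwards [Lp.coeFn_sub G G'] with x hx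
        rw [hx, Pi.sub_apply, smul_sub, inner_sub_left]
    _ = -∫ x in Ω, (R x * ψ x - R' x * ψ x) := by
        rw [integral_sub (hint G) (hint G'), integral_sub (hψ.integrable_lp_mul R)
          (hψ.integrable_lp_mul R'), h ψ hψ, h' ψ hψ]
        ring
    _ = -∫ x in Ω, (R - R') x * ψ x := by
        congr 1
        refine integral_congr_ae ?_
        filter_upwards [Lp.coeFn_sub R R'] with x hx
        rw [hx, Pi.sub_apply, sub_mul]

/-- A solution of `∂ₜ w - ν Δ w = g` with `w = 0` on the boundary and `w(0) = w₀`, seen as a curve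
in `L_1(Ω)`, with `G` the spatial gradient. All curves live on the whole real line, `w` being
extended by `0` to negative times, and the equation is imposed on the mollifications in time by
kernels `ρ` which only look into the past: then `∂ₜ (ρ ⋆ w) = (deriv ρ) ⋆ w`, and the initial datum
enters as the source `ρ t • w₀`. -/
structure IsHeatSolution (Ω : Set H) (T ν : ℝ) (w₀ : Lp ℝ 1 (volume.restrict Ω))
    (w : ℝ → Lp ℝ 1 (volume.restrict Ω)) (G : ℝ → Lp H 2 (volume.restrict Ω))
    (g : ℝ → Lp ℝ 1 (volume.restrict Ω)) : Prop where
  integrable : Integrable w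
  integrable_grad : Integrable G
  integrable_source : Integrable g
  eq_zero_of_nonpos : ∀ s ≤ 0, w s = 0
  mem_closure : ∀ᵐ s, (w s, G s) ∈ (testGraph Ω).topologicalClosure
  hasWeakDivergence : ∀ ρ, IsTestFunction (Ioi 0) ρ → ∀ t ≤ T,
    HasWeakDivergence Ω (fun x => ν • (ρ ⋆ G) t x)
      ((deriv ρ ⋆ w) t - ρ t • w₀ - (ρ ⋆ g) t : Lp ℝ 1 (volume.restrict Ω))

variable {w₀ w₀' : Lp ℝ 1 (volume.restrict Ω)} {w w' g g' : ℝ → Lp ℝ 1 (volume.restrict Ω)}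
  {G G' : ℝ → Lp H 2 (volume.restrict Ω)}

theorem IsHeatSolution.sub (h : IsHeatSolution Ω T ν w₀ w G g)
    (h' : IsHeatSolution Ω T ν w₀' w' G' g') :
    IsHeatSolution Ω T ν (w₀ - w₀') (fun s => w s - w' s) (fun s => G s - G' s)
      (fun s => g s - g' s) where
  integrable := h.integrable.sub h'.integrable
  integrable_grad := h.integrable_grad.sub h'.integrable_grad
  integrable_source := h.integrable_source.sub h'.integrable_source
  eq_zero_of_nonpos s hs := by rw [h.eq_zero_of_nonpos s hs, h'.eq_zero_of_nonpos s hs, sub_zero]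
  mem_closure := by
    filter_upwards [h.mem_closure, h'.mem_closure] with s hs hs'
    exact Submodule.sub_mem _ hs hs'
  hasWeakDivergence ρ hρ t ht := by
    have hdiv := (h.hasWeakDivergence ρ hρ t ht).sub (h'.hasWeakDivergence ρ hρ t ht)
    rw [hρ.convolution_sub h.integrable_grad h'.integrable_grad,
      hρ.convolution_sub h.integrable_source h'.integrable_source,
      hρ.deriv.convolution_sub h.integrable h'.integrable, smul_sub]
    convert hdiv using 3
    abel

theorem IsTestFunction.hasWeakDivergence_gradient {φ : H → ℝ} (hφ : IsTestFunction Ω φ)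
    (ν c : ℝ) : HasWeakDivergence Ω
      (fun x => ν • (c • (hφ.memLp_gradient 2).toLp : Lp H 2 (volume.restrict Ω)) x)
      (c • (ν • (hφ.laplacian.memLp 1).toLp) : Lp ℝ 1 (volume.restrict Ω)) := by
  intro ψ hψ
  have hgrad := (hφ.memLp_gradient (μ := volume.restrict Ω) 2).coeFn_toLp
  have hlap := (hφ.laplacian.memLp (μ := volume.restrict Ω) 1).coeFn_toLp
  calc ∫ x in Ω, inner ℝ (ν • (c • (hφ.memLp_gradient 2).toLp : Lp H 2 _) x) (gradient ψ x)
    _ = ∫ x in Ω, (c * ν) * inner ℝ (gradient φ x) (gradient ψ x) := by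
        refine integral_congr_ae ?_
        filter_upwards [hgrad, Lp.coeFn_smul c (hφ.memLp_gradient 2).toLp] with x hx hcx
        rw [hcx, Pi.smul_apply, hx, smul_smul, real_inner_smul_left, mul_comm ν c]
    _ = -∫ x in Ω, (c * ν) * (Δ φ x * ψ x) := by
        rw [integral_const_mul, integral_const_mul, hφ.integral_inner_gradient_gradient hψ,
          mul_neg]
    _ = -∫ x in Ω, (c • (ν • (hφ.laplacian.memLp 1).toLp) : Lp ℝ 1 _) x * ψ x := by
        congr 1
        refine integral_congr_ae ?_
        filter_upwards [hlap, Lp.coeFn_smul (c * ν) (hφ.laplacian.memLp 1).toLp] with x hx hcx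
        rw [smul_smul, hcx, Pi.smul_apply, hx, smul_eq_mul, mul_assoc, mul_assoc, mul_assoc]

theorem integrable_indicator_Ioo_const {V : Type*} [NormedAddCommGroup V] (T : ℝ) (a : V) :
    Integrable ((Ioo 0 T).indicator fun _ => a) :=
  (integrable_indicator_iff measurableSet_Ioo).2 (integrableOn_const measure_Ioo_lt_top.ne)

theorem IsTestFunction.isHeatSolution {φ : H → ℝ} (hφ : IsTestFunction Ω φ) (hT : 0 ≤ T)
    (ν : ℝ) : IsHeatSolution Ω T ν (hφ.memLp 1).toLp
      ((Ioo 0 T).indicator fun _ => (hφ.memLp 1).toLp)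
      ((Ioo 0 T).indicator fun _ => (hφ.memLp_gradient 2).toLp)
      ((Ioo 0 T).indicator fun _ => -(ν • (hφ.laplacian.memLp 1).toLp)) where
  integrable := integrable_indicator_Ioo_const T _
  integrable_grad := integrable_indicator_Ioo_const T _
  integrable_source := integrable_indicator_Ioo_const T _
  eq_zero_of_nonpos s hs := indicator_of_notMem (fun h => h.1.not_ge hs) _
  mem_closure := ae_of_all _ fun s => by
    by_cases hs : s ∈ Ioo 0 T
    · simp only [indicator_of_mem hs]
      exact Submodule.le_topologicalClosure _ ⟨φ, hφ, (hφ.memLp 1).coeFn_toLp,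
        (hφ.memLp_gradient 2).coeFn_toLp⟩
    · simp only [indicator_of_notMem hs]
      exact Submodule.zero_mem _
  hasWeakDivergence ρ hρ t ht := by
    have hderiv : ∫ s in 0..t, _root_.deriv ρ s = ρ t := by
      rw [intervalIntegral.integral_deriv_eq_sub (fun s _ => hρ.differentiable s)
        hρ.deriv.integrable.intervalIntegrable, hρ.eq_zero_of_notMem self_notMem_Ioi, sub_zero]
    rw [convolution_indicator_const hρ hT ht, convolution_indicator_const hρ hT ht,
      convolution_indicator_const hρ.deriv hT ht, hderiv, sub_self, zero_sub, smul_neg, neg_neg]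
    exact hφ.hasWeakDivergence_gradient ν _

end HeatSolution

section Stability

variable {H : Type*} [NormedAddCommGroup H] [InnerProductSpace ℝ H] [FiniteDimensional ℝ H]
  [MeasurableSpace H] [BorelSpace H] {Ω : Set H} {T ν ε t t₁ t₂ : ℝ}
  {w₀ : Lp ℝ 1 (volume.restrict Ω)} {w g : ℝ → Lp ℝ 1 (volume.restrict Ω)}
  {G : ℝ → Lp H 2 (volume.restrict Ω)} {ρ : ℝ → ℝ}

namespace IsHeatSolution

theorem entropyDeriv_deriv_convolution_le (h : IsHeatSolution Ω T ν w₀ w G g) (hν : 0 ≤ ν)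
    (hε : 0 < ε) (hρ : IsTestFunction (Ioi 0) ρ) (ht : t ≤ T) :
    entropyDeriv ε ((ρ ⋆ w) t) ((deriv ρ ⋆ w) t) ≤
      entropyDeriv ε ((ρ ⋆ w) t) (ρ t • w₀ + (ρ ⋆ g) t) := by
  have hmem : (ρ ⋆ fun s => (w s, G s)) t ∈ (testGraph Ω).topologicalClosure :=
    convolution_mem_of_isClosed (Submodule.isClosed_topologicalClosure _) h.mem_closure ρ t
  have hpair : (ρ ⋆ fun s => (w s, G s)) t = ((ρ ⋆ w) t, (ρ ⋆ G) t) := by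
    simp only [convolution_lsmul_swap]
    exact integral_pair (hρ.integrable_smul h.integrable t)
      (hρ.integrable_smul h.integrable_grad t)
  have hle := entropyDeriv_nonpos_of_hasWeakDivergence hε hν (hpair ▸ hmem)
    (h.hasWeakDivergence ρ hρ t ht)
  rw [sub_sub, entropyDeriv_sub hε] at hle
  exact sub_nonpos.1 hle

theorem continuous_entropyDeriv_convolution (h : IsHeatSolution Ω T ν w₀ w G g) (hε : 0 < ε)
    (hρ : IsTestFunction (Ioi 0) ρ) :
    Continuous fun s => entropyDeriv ε ((ρ ⋆ w) s) (ρ s • w₀ + (ρ ⋆ g) s) :=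
  (continuous_entropyDeriv hε).comp ((hρ.continuous_convolution h.integrable).prodMk
    ((hρ.contDiff.continuous.smul continuous_const).add
      (hρ.continuous_convolution h.integrable_source)))

theorem entropy_convolution_sub_le (h : IsHeatSolution Ω T ν w₀ w G g) (hν : 0 ≤ ν)
    (hε : 0 < ε) (hρ : IsTestFunction (Ioi 0) ρ) (ht : t₁ ≤ t₂) (htT : t₂ ≤ T) :
    entropy ε ((ρ ⋆ w) t₂) - entropy ε ((ρ ⋆ w) t₁) ≤
      ∫ s in t₁..t₂, entropyDeriv ε ((ρ ⋆ w) s) (ρ s • w₀ + (ρ ⋆ g) s) := by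
  have hderiv : IntervalIntegrable
      (fun s => entropyDeriv ε ((ρ ⋆ w) s) ((deriv ρ ⋆ w) s)) volume t₁ t₂ :=
    ((continuous_entropyDeriv hε).comp ((hρ.continuous_convolution h.integrable).prodMk
      (hρ.deriv.continuous_convolution h.integrable))).intervalIntegrable _ _
  rw [← intervalIntegral.integral_eq_sub_of_hasDerivAt (fun s _ =>
    hasDerivAt_entropy_comp hε (hρ.hasDerivAt_convolution h.integrable s)) hderiv]
  exact intervalIntegral.integral_mono_on ht hderiv
    ((h.continuous_entropyDeriv_convolution hε hρ).intervalIntegrable _ _)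
    fun s hs => h.entropyDeriv_deriv_convolution_le hν hε hρ (hs.2.trans htT)

theorem convolution_zero (h : IsHeatSolution Ω T ν w₀ w G g) (hρ : IsTestFunction (Ioi 0) ρ) :
    (ρ ⋆ w) 0 = 0 := by
  rw [convolution_lsmul_swap]
  refine integral_eq_zero_of_ae (ae_of_all _ fun s => ?_)
  change ρ (0 - s) • w s = 0
  rcases le_total s 0 with hs | hs
  · rw [h.eq_zero_of_nonpos s hs, smul_zero]
  · rw [hρ.eq_zero_of_notMem (notMem_Ioi.2 (sub_nonpos.2 hs)), zero_smul]

theorem norm_convolution_le (h : IsHeatSolution Ω T ν w₀ w G g) (hν : 0 ≤ ν)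
    (hρ : IsTestFunction (Ioi 0) ρ) (ht : t ∈ Icc 0 T) :
    ‖(ρ ⋆ w) t‖ ≤ (∫ s, ‖ρ s‖) * ‖w₀‖ + ∫ s, ‖(ρ ⋆ g) s‖ := by
  have hρw : Integrable fun s => ρ s • w₀ := hρ.integrable.smul_const w₀
  have hρg : Integrable (ρ ⋆ g) := hρ.integrable.integrable_convolution _ h.integrable_source
  have hsource : Integrable fun s => ‖ρ s • w₀ + (ρ ⋆ g) s‖ := (hρw.add hρg).norm
  have hentropy : ∀ ε > 0, entropy ε ((ρ ⋆ w) t) - entropy ε ((ρ ⋆ w) 0) ≤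
      (∫ s, ‖ρ s‖) * ‖w₀‖ + ∫ s, ‖(ρ ⋆ g) s‖ := fun ε hε => by
    calc entropy ε ((ρ ⋆ w) t) - entropy ε ((ρ ⋆ w) 0)
      _ ≤ ∫ s in 0..t, entropyDeriv ε ((ρ ⋆ w) s) (ρ s • w₀ + (ρ ⋆ g) s) :=
          h.entropy_convolution_sub_le hν hε hρ ht.1 ht.2
      _ ≤ ∫ s in 0..t, ‖ρ s • w₀ + (ρ ⋆ g) s‖ :=
          intervalIntegral.integral_mono_on ht.1
            ((h.continuous_entropyDeriv_convolution hε hρ).intervalIntegrable _ _)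
            hsource.intervalIntegrable
            fun s _ => (le_abs_self _).trans (abs_entropyDeriv_le hε _ _)
      _ ≤ ∫ s, ‖ρ s • w₀ + (ρ ⋆ g) s‖ := by
          rw [intervalIntegral.integral_of_le ht.1]
          exact setIntegral_le_integral hsource (ae_of_all _ fun _ => norm_nonneg _)
      _ ≤ ∫ s, (‖ρ s‖ * ‖w₀‖ + ‖(ρ ⋆ g) s‖) :=
          integral_mono hsource ((hρ.integrable.norm.mul_const _).add hρg.norm)
            fun s => (norm_add_le _ _).trans_eq (by rw [norm_smul])
      _ = (∫ s, ‖ρ s‖) * ‖w₀‖ + ∫ s, ‖(ρ ⋆ g) s‖ := by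
          rw [integral_add (hρ.integrable.norm.mul_const _) hρg.norm, integral_mul_const]
  have hlim := (tendsto_entropy ((ρ ⋆ w) t)).sub (tendsto_entropy ((ρ ⋆ w) 0))
  rw [h.convolution_zero hρ, norm_zero, sub_zero] at hlim
  refine le_of_tendsto hlim ?_
  filter_upwards [self_mem_nhdsWithin] with ε hε
  exact h.convolution_zero hρ ▸ hentropy ε hε

/- Testing against `w` itself would only bound the mollifications by `‖w₀‖`; subtracting a test
function close to `w₀` makes the initial datum small. -/
theorem norm_convolution_sub_le (h : IsHeatSolution Ω T ν w₀ w G g) (hν : 0 ≤ ν) {φ : H → ℝ}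
    (hφ : IsTestFunction Ω φ) (hρ : IsTestFunction (Ioi 0) ρ) (ht : t ∈ Icc 0 T) :
    ‖(ρ ⋆ w) t - (∫ s in 0..t, ρ s) • w₀‖ ≤ 2 * (∫ s, ‖ρ s‖) * ‖w₀ - (hφ.memLp 1).toLp‖ +
      ∫ s, ‖(ρ ⋆ fun r => g r -
        (Ioo 0 T).indicator (fun _ => -(ν • (hφ.laplacian.memLp 1).toLp)) r) s‖ := by
  have hT : 0 ≤ T := ht.1.trans ht.2
  have hstat := hφ.isHeatSolution hT ν
  have hbound := (h.sub hstat).norm_convolution_le hν hρ ht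
  rw [hρ.convolution_sub h.integrable hstat.integrable,
    convolution_indicator_const hρ hT ht.2] at hbound
  have hmass : ‖∫ s in 0..t, ρ s‖ ≤ ∫ s, ‖ρ s‖ :=
    (intervalIntegral.norm_integral_le_integral_norm ht.1).trans (by
      rw [intervalIntegral.integral_of_le ht.1]
      exact setIntegral_le_integral hρ.integrable.norm (ae_of_all _ fun _ => norm_nonneg _))
  set a : Lp ℝ 1 (volume.restrict Ω) := (hφ.memLp 1).toLp
  calc ‖(ρ ⋆ w) t - (∫ s in 0..t, ρ s) • w₀‖
    _ = ‖((ρ ⋆ w) t - (∫ s in 0..t, ρ s) • a) - (∫ s in 0..t, ρ s) • (w₀ - a)‖ := by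
        rw [smul_sub, sub_sub, add_sub_cancel]
    _ ≤ ‖(ρ ⋆ w) t - (∫ s in 0..t, ρ s) • a‖ + ‖∫ s in 0..t, ρ s‖ * ‖w₀ - a‖ :=
        (norm_sub_le _ _).trans_eq (by rw [norm_smul])
    _ ≤ _ := by linarith [mul_le_mul_of_nonneg_right hmass (norm_nonneg (w₀ - a))]

end IsHeatSolution

end Stability

section ContinuousRepresentative

theorem exists_isTestFunction_norm_sub_toLp_lt {V : Type*} [NormedAddCommGroup V]
    [NormedSpace ℝ V] [FiniteDimensional ℝ V] [MeasurableSpace V] [BorelSpace V] {μ : Measure V}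
    [IsFiniteMeasureOnCompacts μ] {Ω : Set V} (hΩ : IsOpen Ω) (a : Lp ℝ 1 (μ.restrict Ω))
    {δ : ℝ} (hδ : 0 < δ) :
    ∃ (φ : V → ℝ) (hφ : IsTestFunction Ω φ), ‖a - (hφ.memLp 1).toLp‖ < δ := by
  obtain ⟨φ, hφ, hlt⟩ := exists_isTestFunction_integral_norm_sub_lt hΩ (L1.integrable_coeFn a) hδ
  refine ⟨φ, hφ, ?_⟩
  rw [L1.norm_eq_integral_norm]
  refine (integral_congr_ae ?_).trans_lt hlt
  filter_upwards [Lp.coeFn_sub a (hφ.memLp 1).toLp, (hφ.memLp 1).coeFn_toLp] with x hx hφx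
  rw [hx, Pi.sub_apply, hφx]

theorem integral_norm_timeKernel_sub_le (m k : ℕ) :
    ∫ s, ‖timeKernel m s - timeKernel k s‖ ≤ 2 := by
  have hm := (isTestFunction_timeKernel m).integrable
  have hk := (isTestFunction_timeKernel k).integrable
  calc ∫ s, ‖timeKernel m s - timeKernel k s‖
    _ ≤ ∫ s, (‖timeKernel m s‖ + ‖timeKernel k s‖) :=
        integral_mono (hm.sub hk).norm (hm.norm.add hk.norm) fun s => norm_sub_le _ _
    _ = 2 := by
        rw [integral_add hm.norm hk.norm, integral_norm_timeKernel, integral_norm_timeKernel]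
        norm_num

theorem IsTestFunction.integral_norm_sub_convolution_le {V : Type*} [NormedAddCommGroup V]
    [NormedSpace ℝ V] {U : Set ℝ} {ρ σ : ℝ → ℝ} (hρ : IsTestFunction U ρ)
    (hσ : IsTestFunction U σ) {K : ℝ → V} (hK : Integrable K) :
    ∫ s, ‖((fun r => ρ r - σ r) ⋆ K) s‖ ≤
      (∫ s, ‖(ρ ⋆ K) s - K s‖) + ∫ s, ‖(σ ⋆ K) s - K s‖ := by
  have hρK : Integrable fun s => ‖(ρ ⋆ K) s - K s‖ :=
    ((hρ.integrable.integrable_convolution _ hK).sub hK).norm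
  have hσK : Integrable fun s => ‖(σ ⋆ K) s - K s‖ :=
    ((hσ.integrable.integrable_convolution _ hK).sub hK).norm
  rw [← integral_add hρK hσK]
  refine integral_mono ((hρ.sub hσ).integrable.integrable_convolution _ hK).norm
    (hρK.add hσK) fun s => ?_
  change ‖((fun r => ρ r - σ r) ⋆ K) s‖ ≤ ‖(ρ ⋆ K) s - K s‖ + ‖(σ ⋆ K) s - K s‖
  rw [hρ.sub_convolution hσ hK, ← sub_sub_sub_cancel_right _ _ (K s)]
  exact norm_sub_le _ _

/-- The mollification in time of the curve `w`, after `w` has been extended to negative times by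
its initial value `w₀`; the part of the kernel which sees negative times has mass
`1 - ∫ s in 0..t, timeKernel m s`. -/
def timeApprox {V : Type*} [NormedAddCommGroup V] [NormedSpace ℝ V] (w₀ : V) (w : ℝ → V) (m : ℕ)
    (t : ℝ) : V :=
  (timeKernel m ⋆ w) t + (1 - ∫ s in 0..t, timeKernel m s) • w₀

section TimeApprox

variable {V : Type*} [NormedAddCommGroup V] [NormedSpace ℝ V] {w : ℝ → V}

theorem continuous_timeApprox (w₀ : V) (hw : Integrable w) (m : ℕ) :
    Continuous (timeApprox w₀ w m) := by
  have hρ := isTestFunction_timeKernel m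
  exact (hρ.continuous_convolution hw).add ((continuous_const.sub
    (intervalIntegral.continuous_primitive
      (fun _ _ => hρ.integrable.intervalIntegrable) 0)).smul continuous_const)

theorem timeApprox_sub_timeApprox (w₀ : V) (hw : Integrable w) (m k : ℕ) (t : ℝ) :
    timeApprox w₀ w m t - timeApprox w₀ w k t =
      ((fun s => timeKernel m s - timeKernel k s) ⋆ w) t -
        (∫ s in 0..t, (timeKernel m s - timeKernel k s)) • w₀ := by
  have hm := isTestFunction_timeKernel m
  have hk := isTestFunction_timeKernel k
  rw [hm.sub_convolution hk hw, intervalIntegral.integral_sub hm.integrable.intervalIntegrable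
    hk.integrable.intervalIntegrable, timeApprox, timeApprox]
  module

theorem timeApprox_eq_convolution (w₀ : V) (w : ℝ → V) {m : ℕ} {t s : ℝ}
    (hm : IsTestFunction (Ioo 0 t) (timeKernel m)) (ht : 0 ≤ t) (hs : t ≤ s) :
    timeApprox w₀ w m s = (timeKernel m ⋆ w) s := by
  have hmass : ∫ r in 0..s, timeKernel m r = 1 := by
    rw [← integral_timeKernel m, intervalIntegral.integral_of_le (ht.trans hs)]
    refine setIntegral_eq_integral_of_forall_compl_eq_zero fun r hr => ?_
    by_contra hne
    have hmem := hm.tsupport_subset (subset_tsupport _ hne)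
    exact hr ⟨hmem.1, hmem.2.le.trans hs⟩
  rw [timeApprox, hmass, sub_self, zero_smul, add_zero]

end TimeApprox

namespace IsHeatSolution

variable {H : Type*} [NormedAddCommGroup H] [InnerProductSpace ℝ H] [FiniteDimensional ℝ H]
  [MeasurableSpace H] [BorelSpace H] {Ω : Set H} {T ν ε t₁ t₂ : ℝ}
  {w₀ : Lp ℝ 1 (volume.restrict Ω)} {w g v : ℝ → Lp ℝ 1 (volume.restrict Ω)}
  {G : ℝ → Lp H 2 (volume.restrict Ω)}

theorem exists_norm_convolution_sub_le (h : IsHeatSolution Ω T ν w₀ w G g) (hΩ : IsOpen Ω)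
    (hν : 0 ≤ ν) {δ : ℝ} (hδ : 0 < δ) :
    ∃ K : ℝ → Lp ℝ 1 (volume.restrict Ω), Integrable K ∧
      ∀ ρ, IsTestFunction (Ioi 0) ρ → ∀ t ∈ Icc 0 T,
        ‖(ρ ⋆ w) t - (∫ s in 0..t, ρ s) • w₀‖ ≤ δ * (∫ s, ‖ρ s‖) + ∫ s, ‖(ρ ⋆ K) s‖ := by
  obtain ⟨φ, hφ, hlt⟩ := exists_isTestFunction_norm_sub_toLp_lt hΩ w₀ (half_pos hδ)
  refine ⟨_, h.integrable_source.sub (integrable_indicator_Ioo_const T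
    (-(ν • (hφ.laplacian.memLp 1).toLp))), fun ρ hρ t ht =>
      (h.norm_convolution_sub_le hν hφ hρ ht).trans (add_le_add_left ?_ _)⟩
  have hρ₀ : 0 ≤ ∫ s, ‖ρ s‖ := integral_nonneg fun _ => norm_nonneg _
  nlinarith

theorem uniformCauchySeqOn_timeApprox (h : IsHeatSolution Ω T ν w₀ w G g) (hΩ : IsOpen Ω)
    (hν : 0 ≤ ν) : UniformCauchySeqOn (timeApprox w₀ w) atTop (Icc 0 T) := by
  refine Metric.uniformCauchySeqOn_iff.2 fun δ hδ => ?_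
  obtain ⟨K, hK, hle⟩ := h.exists_norm_convolution_sub_le hΩ hν (show 0 < δ / 4 by positivity)
  obtain ⟨N, hN⟩ := eventually_atTop.1
    ((tendsto_integral_norm_convolution_sub hK).eventually_lt_const (show 0 < δ / 4 by positivity))
  refine ⟨N, fun m hm k hk t ht => ?_⟩
  have hρ := (isTestFunction_timeKernel m).sub (isTestFunction_timeKernel k)
  calc dist (timeApprox w₀ w m t) (timeApprox w₀ w k t)
    _ = ‖((fun s => timeKernel m s - timeKernel k s) ⋆ w) t -
          (∫ s in 0..t, (timeKernel m s - timeKernel k s)) • w₀‖ := by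
        rw [dist_eq_norm, timeApprox_sub_timeApprox w₀ h.integrable]
    _ ≤ δ / 4 * (∫ s, ‖timeKernel m s - timeKernel k s‖) +
          ∫ s, ‖((fun s => timeKernel m s - timeKernel k s) ⋆ K) s‖ := hle _ hρ t ht
    _ ≤ δ / 4 * 2 + ((∫ s, ‖(timeKernel m ⋆ K) s - K s‖) +
          ∫ s, ‖(timeKernel k ⋆ K) s - K s‖) :=
        add_le_add (mul_le_mul_of_nonneg_left (integral_norm_timeKernel_sub_le m k)
            (by positivity))
          ((isTestFunction_timeKernel m).integral_norm_sub_convolution_le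
            (isTestFunction_timeKernel k) hK)
    _ < δ := by linarith [hN m hm, hN k hk]

theorem exists_tendstoUniformlyOn_timeApprox (h : IsHeatSolution Ω T ν w₀ w G g) (hΩ : IsOpen Ω)
    (hν : 0 ≤ ν) : ∃ v, TendstoUniformlyOn (timeApprox w₀ w) v atTop (Icc 0 T) := by
  have hcauchy := h.uniformCauchySeqOn_timeApprox hΩ hν
  have hex : ∀ t, ∃ a, t ∈ Icc 0 T → Tendsto (fun m => timeApprox w₀ w m t) atTop (𝓝 a) :=
    fun t => by
      by_cases ht : t ∈ Icc 0 T
      · obtain ⟨a, ha⟩ := cauchySeq_tendsto_of_complete (hcauchy.cauchySeq ht)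
        exact ⟨a, fun _ => ha⟩
      · exact ⟨0, fun h => (ht h).elim⟩
  choose v hv using hex
  exact ⟨v, hcauchy.tendstoUniformlyOn_of_tendsto fun t ht => hv t ht⟩

theorem continuousOn_of_tendstoUniformlyOn (h : IsHeatSolution Ω T ν w₀ w G g)
    (hv : TendstoUniformlyOn (timeApprox w₀ w) v atTop (Icc 0 T)) : ContinuousOn v (Icc 0 T) :=
  hv.continuousOn (.of_forall fun m => (continuous_timeApprox w₀ h.integrable m).continuousOn)

theorem eq_initial_of_tendstoUniformlyOn (h : IsHeatSolution Ω T ν w₀ w G g) (hT : 0 ≤ T)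
    (hv : TendstoUniformlyOn (timeApprox w₀ w) v atTop (Icc 0 T)) : v 0 = w₀ := by
  have hzero : ∀ m, timeApprox w₀ w m 0 = w₀ := fun m => by
    rw [timeApprox, h.convolution_zero (isTestFunction_timeKernel m),
      intervalIntegral.integral_same, sub_zero, one_smul, zero_add]
  have hlim := hv.tendsto_at (left_mem_Icc.2 hT)
  simp only [hzero] at hlim
  exact tendsto_nhds_unique hlim tendsto_const_nhds

theorem tendsto_convolution_of_tendstoUniformlyOn
    (hv : TendstoUniformlyOn (timeApprox w₀ w) v atTop (Icc 0 T)) {t : ℝ} (ht : t ∈ Ioc 0 T) :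
    Tendsto (fun m => (timeKernel m ⋆ w) t) atTop (𝓝 (v t)) := by
  refine (hv.tendsto_at (Ioc_subset_Icc_self ht)).congr' ?_
  filter_upwards [eventually_isTestFunction_timeKernel ht.1] with m hm
  exact timeApprox_eq_convolution w₀ w hm ht.1.le le_rfl

theorem ae_eq_of_tendstoUniformlyOn (h : IsHeatSolution Ω T ν w₀ w G g)
    (hv : TendstoUniformlyOn (timeApprox w₀ w) v atTop (Icc 0 T)) :
    ∀ᵐ t ∂(volume.restrict (Ioc 0 T)), v t = w t := by
  obtain ⟨ns, hns, hlim⟩ := exists_seq_tendsto_ae_convolution_timeKernel h.integrable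
  filter_upwards [ae_restrict_of_ae hlim, ae_restrict_mem measurableSet_Ioc] with t ht htT
  exact tendsto_nhds_unique
    ((tendsto_convolution_of_tendstoUniformlyOn hv htT).comp hns.tendsto_atTop) ht

end IsHeatSolution

end ContinuousRepresentative

section Contraction

theorem integrable_entropyDeriv {X : Type*} [MeasurableSpace X] {μ : Measure X} {S : Set ℝ}
    {a k : ℝ → Lp ℝ 1 μ} (hε : 0 < ε) (ha : AEStronglyMeasurable a (volume.restrict S))
    (hk : IntegrableOn k S) : IntegrableOn (fun s => entropyDeriv ε (a s) (k s)) S :=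
  hk.norm.mono ((continuous_entropyDeriv hε).comp_aestronglyMeasurable (ha.prodMk hk.1))
    (ae_of_all _ fun _ => (abs_entropyDeriv_le hε _ _).trans_eq (norm_norm _).symm)

variable {H : Type*} [NormedAddCommGroup H] [InnerProductSpace ℝ H] [FiniteDimensional ℝ H]
  [MeasurableSpace H] [BorelSpace H] {Ω : Set H} {T ν ε t₁ t₂ : ℝ}
  {w₀ : Lp ℝ 1 (volume.restrict Ω)} {w g v : ℝ → Lp ℝ 1 (volume.restrict Ω)}
  {G : ℝ → Lp H 2 (volume.restrict Ω)}

namespace IsHeatSolution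

theorem entropy_convolution_sub_le_add (h : IsHeatSolution Ω T ν w₀ w G g) (hν : 0 ≤ ν)
    (hε : 0 < ε) {ρ : ℝ → ℝ} (hρ : IsTestFunction (Ioo 0 t₁) ρ) (ht : t₁ ≤ t₂) (htT : t₂ ≤ T) :
    entropy ε ((ρ ⋆ w) t₂) - entropy ε ((ρ ⋆ w) t₁) ≤
      (∫ s in t₁..t₂, entropyDeriv ε ((ρ ⋆ w) s) (g s)) + ∫ s, ‖(ρ ⋆ g) s - g s‖ := by
  have hρ₀ : IsTestFunction (Ioi 0) ρ := hρ.mono Ioo_subset_Ioi_self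
  have hw : Continuous (ρ ⋆ w) := hρ.continuous_convolution h.integrable
  have hmain : IntervalIntegrable (fun s => entropyDeriv ε ((ρ ⋆ w) s) (g s)) volume t₁ t₂ :=
    (intervalIntegrable_iff_integrableOn_Ioc_of_le ht).2
      (integrable_entropyDeriv hε hw.aestronglyMeasurable h.integrable_source.integrableOn)
  have herr : Integrable fun s => ‖(ρ ⋆ g) s - g s‖ :=
    ((hρ.integrable.integrable_convolution _ h.integrable_source).sub h.integrable_source).norm
  calc entropy ε ((ρ ⋆ w) t₂) - entropy ε ((ρ ⋆ w) t₁)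
    _ ≤ ∫ s in t₁..t₂, entropyDeriv ε ((ρ ⋆ w) s) (ρ s • w₀ + (ρ ⋆ g) s) :=
        h.entropy_convolution_sub_le hν hε hρ₀ ht htT
    _ ≤ ∫ s in t₁..t₂, (entropyDeriv ε ((ρ ⋆ w) s) (g s) + ‖(ρ ⋆ g) s - g s‖) := by
        refine intervalIntegral.integral_mono_on ht
          ((h.continuous_entropyDeriv_convolution hε hρ₀).intervalIntegrable _ _)
          (hmain.add herr.intervalIntegrable) fun s hs => ?_
        rw [hρ.eq_zero_of_notMem fun hs' => hs'.2.not_ge hs.1, zero_smul, zero_add,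
          ← sub_le_iff_le_add']
        exact (le_abs_self _).trans (abs_entropyDeriv_sub_le hε _ _ _)
    _ ≤ (∫ s in t₁..t₂, entropyDeriv ε ((ρ ⋆ w) s) (g s)) + ∫ s, ‖(ρ ⋆ g) s - g s‖ := by
        rw [intervalIntegral.integral_add hmain herr.intervalIntegrable,
          intervalIntegral.integral_of_le ht (f := fun s => ‖(ρ ⋆ g) s - g s‖)]
        exact add_le_add le_rfl (setIntegral_le_integral herr (ae_of_all _ fun _ => norm_nonneg _))

theorem entropy_sub_le_of_tendstoUniformlyOn (h : IsHeatSolution Ω T ν w₀ w G g) (hν : 0 ≤ ν)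
    (hv : TendstoUniformlyOn (timeApprox w₀ w) v atTop (Icc 0 T)) (hε : 0 < ε) (ht₁ : 0 < t₁)
    (ht : t₁ ≤ t₂) (htT : t₂ ≤ T) :
    entropy ε (v t₂) - entropy ε (v t₁) ≤ ∫ s in t₁..t₂, entropyDeriv ε (v s) (g s) := by
  have hlim : ∀ t ∈ Icc t₁ t₂, Tendsto (fun m => (timeKernel m ⋆ w) t) atTop (𝓝 (v t)) :=
    fun t htt => tendsto_convolution_of_tendstoUniformlyOn hv
      ⟨ht₁.trans_le htt.1, htt.2.trans htT⟩
  have hleft : Tendsto (fun m => entropy ε ((timeKernel m ⋆ w) t₂) -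
      entropy ε ((timeKernel m ⋆ w) t₁)) atTop (𝓝 (entropy ε (v t₂) - entropy ε (v t₁))) :=
    (((continuous_entropy hε).tendsto _).comp (hlim t₂ (right_mem_Icc.2 ht))).sub
      (((continuous_entropy hε).tendsto _).comp (hlim t₁ (left_mem_Icc.2 ht)))
  have hright : Tendsto (fun m => ∫ s in t₁..t₂, entropyDeriv ε ((timeKernel m ⋆ w) s) (g s))
      atTop (𝓝 (∫ s in t₁..t₂, entropyDeriv ε (v s) (g s))) := by
    refine intervalIntegral.tendsto_integral_filter_of_dominated_convergence (fun s => ‖g s‖)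
      (.of_forall fun m => (integrable_entropyDeriv hε ((isTestFunction_timeKernel
        m).continuous_convolution h.integrable).aestronglyMeasurable
          h.integrable_source.integrableOn).1)
      (.of_forall fun m => ae_of_all _ fun s _ => abs_entropyDeriv_le hε _ _)
      h.integrable_source.norm.intervalIntegrable (ae_of_all _ fun s hs => ?_)
    rw [uIoc_of_le ht] at hs
    exact ((continuous_entropyDeriv_left hε (g s)).tendsto _).comp
      (hlim s (Ioc_subset_Icc_self hs))
  have hbound := hright.add (tendsto_integral_norm_convolution_sub h.integrable_source)
  rw [add_zero] at hbound
  refine le_of_tendsto_of_tendsto hleft hbound ?_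
  filter_upwards [eventually_isTestFunction_timeKernel ht₁] with m hm
  exact h.entropy_convolution_sub_le_add hν hε hm ht htT

theorem norm_sub_le_of_pos (h : IsHeatSolution Ω T ν w₀ w G g) (hν : 0 ≤ ν)
    (hv : TendstoUniformlyOn (timeApprox w₀ w) v atTop (Icc 0 T)) {θ : ℝ → ℝ}
    (hθ : IntegrableOn θ (Ioc 0 T))
    (hgθ : ∀ ε > 0, ∀ᵐ s ∂(volume.restrict (Ioc 0 T)), entropyDeriv ε (w s) (g s) ≤ θ s)
    (ht₁ : 0 < t₁) (ht : t₁ ≤ t₂) (htT : t₂ ≤ T) : ‖v t₂‖ - ‖v t₁‖ ≤ ∫ s in t₁..t₂, θ s := by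
  have hsub : Ioc t₁ t₂ ⊆ Ioc 0 T := Ioc_subset_Ioc ht₁.le htT
  have hvmeas : AEStronglyMeasurable v (volume.restrict (Ioc t₁ t₂)) :=
    ((h.continuousOn_of_tendstoUniformlyOn hv).mono
      (hsub.trans Ioc_subset_Icc_self)).aestronglyMeasurable measurableSet_Ioc
  refine le_of_tendsto ((tendsto_entropy (v t₂)).sub (tendsto_entropy (v t₁))) ?_
  filter_upwards [self_mem_nhdsWithin] with ε hε
  refine (h.entropy_sub_le_of_tendstoUniformlyOn hν hv hε ht₁ ht htT).trans ?_
  rw [intervalIntegral.integral_of_le ht, intervalIntegral.integral_of_le ht]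
  refine integral_mono_ae
    (integrable_entropyDeriv hε hvmeas h.integrable_source.integrableOn) (hθ.mono_set hsub) ?_
  filter_upwards [ae_restrict_of_ae_restrict_of_subset hsub (hgθ ε hε),
    ae_restrict_of_ae_restrict_of_subset hsub (h.ae_eq_of_tendstoUniformlyOn hv)] with s hs hvs
  rwa [hvs]

theorem norm_le_norm_add_integral (h : IsHeatSolution Ω T ν w₀ w G g) (hν : 0 ≤ ν)
    (hv : TendstoUniformlyOn (timeApprox w₀ w) v atTop (Icc 0 T)) {θ : ℝ → ℝ}
    (hθ : IntegrableOn θ (Ioc 0 T))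
    (hgθ : ∀ ε > 0, ∀ᵐ s ∂(volume.restrict (Ioc 0 T)), entropyDeriv ε (w s) (g s) ≤ θ s)
    (ht₁ : 0 ≤ t₁) (ht : t₁ ≤ t₂) (htT : t₂ ≤ T) : ‖v t₂‖ ≤ ‖v t₁‖ + ∫ s in t₁..t₂, θ s := by
  rcases ht.eq_or_lt with rfl | hlt
  · simp
  have hcont : ContinuousOn (fun t => ‖v t₂‖ - ‖v t‖ - ∫ s in t..t₂, θ s) (Icc t₁ t₂) := by
    refine (continuousOn_const.sub ((h.continuousOn_of_tendstoUniformlyOn hv).mono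
      (Icc_subset_Icc ht₁ htT)).norm).sub ?_
    rw [← uIcc_of_le ht]
    refine intervalIntegral.continuousOn_primitive_interval_left ?_
    rw [uIcc_of_le ht, integrableOn_Icc_iff_integrableOn_Ioc]
    exact hθ.mono_set (Ioc_subset_Ioc ht₁ htT)
  have hle : ∀ t ∈ Ioo t₁ t₂, ‖v t₂‖ - ‖v t‖ - ∫ s in t..t₂, θ s ≤ 0 := fun t htt =>
    sub_nonpos.2 (h.norm_sub_le_of_pos hν hv hθ hgθ (ht₁.trans_lt htt.1) htt.2.le htT)
  rw [← closure_Ioo hlt.ne] at hcont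
  have hend := le_on_closure hle hcont continuousOn_const
    (closure_Ioo hlt.ne ▸ left_mem_Icc.2 ht)
  linarith

end IsHeatSolution

end Contraction

section WeakSolutions

variable {n : ℕ} {Ω : Set (E n)} {T ν : ℝ} {b : E n × ℝ → E n} {u₀ : E n → ℝ}
  {f u : E n × ℝ → ℝ}

theorem real_inner_eq_mul (a b : ℝ) : inner ℝ a b = a * b :=
  mul_comm b a

theorem IsWeakSolution.exists_integral_eq [IsFiniteMeasure (volume.restrict Ω)]
    (hu : IsWeakSolution Ω T ν b u₀ f u) (hb : MemLp b 2 (volume.restrict (cylinder Ω T)))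
    (hf : MemLp f 1 (volume.restrict (cylinder Ω T))) :
    ∃ G, MemEnergyClass Ω T u G ∧ ∀ ρ, IsTestFunction (Ioi 0) ρ → ∀ t ≤ T, ∀ ψ,
      IsTestFunction Ω ψ →
        (∫ z in cylinder Ω T, deriv ρ (t - z.2) * (u z * ψ z.1)) +
            ν * ∫ z in cylinder Ω T, ρ (t - z.2) * inner ℝ (G z) (gradient ψ z.1) =
          (ρ t * ∫ x in Ω, u₀ x * ψ x) +
            ∫ z in cylinder Ω T, ρ (t - z.2) * ((f z - inner ℝ (b z) (G z)) * ψ z.1) := by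
  obtain ⟨G, hG, heq⟩ := hu
  refine ⟨G, hG, fun ρ hρ t ht ψ hψ => ?_⟩
  have hη := heq _ (hψ.prod_mul_comp_sub hρ (t := t) fun s hs => (sub_pos.1 hs).trans_le ht)
  have hu₂ := hG.memLp
  have hG₂ := hG.memLp_grad
  simp only [gradX_mul_comp_sub hψ, derivT_mul_comp_sub hρ.differentiable, inner_smul_right,
    sub_zero, volume_restrict_cylinder] at hb hf hu₂ hG₂ hη ⊢
  set π := (volume.restrict Ω).prod (volume.restrict (Ioo 0 T))
  have hbG : MemLp (fun z => inner ℝ (b z) (G z)) 1 π :=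
    (innerSL ℝ (E := E n)).memLp_of_bilin 1 hb hG₂
  have hu_int := hρ.deriv.integrable_comp_sub_mul_inner (hu₂.mono_exponent one_le_two)
    (hψ.memLp ⊤) t
  have hG_int := (hρ.integrable_comp_sub_mul_inner hG₂ (hψ.memLp_gradient 2) t).const_mul ν
  have hf_int := hρ.integrable_comp_sub_mul_inner hf (hψ.memLp ⊤) t
  have hbG_int := hρ.integrable_comp_sub_mul_inner hbG (hψ.memLp ⊤) t
  simp only [real_inner_eq_mul] at hu_int hf_int hbG_int
  calc (∫ z, deriv ρ (t - z.2) * (u z * ψ z.1) ∂π) +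
        ν * ∫ z, ρ (t - z.2) * inner ℝ (G z) (gradient ψ z.1) ∂π
    _ = ∫ z, (-(u z * -(deriv ρ (t - z.2) * ψ z.1)) +
          ν * (ρ (t - z.2) * inner ℝ (G z) (gradient ψ z.1))) ∂π := by
        rw [← integral_const_mul, ← integral_add hu_int hG_int]
        congr with z
        ring
    _ = (∫ x in Ω, u₀ x * (ρ t * ψ x)) + ((∫ z, f z * (ρ (t - z.2) * ψ z.1) ∂π) -
          ∫ z, inner ℝ (b z) (G z) * (ρ (t - z.2) * ψ z.1) ∂π) := by
        rw [← add_sub_assoc, ← hη, add_sub_cancel_right]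
    _ = (ρ t * ∫ x in Ω, u₀ x * ψ x) +
          ∫ z, ρ (t - z.2) * ((f z - inner ℝ (b z) (G z)) * ψ z.1) ∂π := by
        simp only [mul_left_comm _ (ρ _), integral_const_mul]
        rw [← integral_sub hf_int hbG_int]
        simp only [sub_mul, mul_sub, π]

theorem IsTestFunction.integral_sub_smul_sub_mul {V : Type*} [NormedAddCommGroup V]
    [NormedSpace ℝ V] [MeasurableSpace V] [OpensMeasurableSpace V] {μ : Measure V}
    [IsFiniteMeasureOnCompacts μ] {U : Set V} {ψ : V → ℝ} (hψ : IsTestFunction U ψ)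
    (a k l : Lp ℝ 1 μ) (c : ℝ) :
    ∫ x, (a - c • k - l) x * ψ x ∂μ =
      (∫ x, a x * ψ x ∂μ) - (c * ∫ x, k x * ψ x ∂μ) - ∫ x, l x * ψ x ∂μ := by
  have hak : Integrable (fun x => a x * ψ x - c * (k x * ψ x)) μ :=
    (hψ.integrable_lp_mul a).sub ((hψ.integrable_lp_mul k).const_mul c)
  rw [← integral_const_mul, ← integral_sub (hψ.integrable_lp_mul a)
    ((hψ.integrable_lp_mul k).const_mul c), ← integral_sub hak (hψ.integrable_lp_mul l)]
  refine integral_congr_ae ?_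
  filter_upwards [Lp.coeFn_sub (a - c • k) l, Lp.coeFn_sub a (c • k), Lp.coeFn_smul c k]
    with x hx hx' hx''
  rw [hx, Pi.sub_apply, hx', Pi.sub_apply, hx'', Pi.smul_apply, smul_eq_mul]
  ring

theorem IsWeakSolution.exists_isHeatSolution [IsFiniteMeasure (volume.restrict Ω)]
    (hu : IsWeakSolution Ω T ν b u₀ f u) (hb : MemLp b 2 (volume.restrict (cylinder Ω T)))
    (hf : MemLp f 1 (volume.restrict (cylinder Ω T))) (hu₀ : MemLp u₀ 1 (volume.restrict Ω)) :
    ∃ G, MemLp G 2 (volume.restrict (cylinder Ω T)) ∧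
      IsHeatSolution Ω T ν hu₀.toLp (cylinderSlice Ω T 1 u) (cylinderSlice Ω T 2 G)
        (cylinderSlice Ω T 1 fun z => f z - inner ℝ (b z) (G z)) := by
  have : Fact ((1 : ℝ≥0∞) ≠ ⊤) := ⟨ENNReal.one_ne_top⟩
  have : Fact ((2 : ℝ≥0∞) ≠ ⊤) := ⟨ENNReal.ofNat_ne_top⟩
  obtain ⟨G, hG, heq⟩ := hu.exists_integral_eq hb hf
  refine ⟨G, hG.memLp_grad, ?_⟩
  have hu₂ := hG.memLp
  have hG₂ := hG.memLp_grad
  simp only [volume_restrict_cylinder] at hb hf hu₂ hG₂ heq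
  have hu₁ := hu₂.mono_exponent one_le_two
  have hg : MemLp (fun z => f z - inner ℝ (b z) (G z)) 1
      ((volume.restrict Ω).prod (volume.restrict (Ioo 0 T))) :=
    hf.sub ((innerSL ℝ (E := E n)).memLp_of_bilin 1 hb hG₂)
  have hIm : MeasurableSet (Ioo 0 T) := measurableSet_Ioo
  have hIfin : volume (Ioo 0 T) ≠ ⊤ := measure_Ioo_lt_top.ne
  refine ⟨integrable_indicator_slice hIm hIfin hu₁, integrable_indicator_slice hIm hIfin hG₂,
    integrable_indicator_slice hIm hIfin hg, fun s hs => indicator_of_notMem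
      (fun hs' => hs'.1.not_ge hs) _, ?_, fun ρ hρ t ht ψ hψ => ?_⟩
  · have hslice : ∀ᵐ s ∂(volume.restrict (Ioo 0 T)), (slice 1 (volume.restrict Ω) u s,
        slice 2 (volume.restrict Ω) G s) ∈ (testGraph Ω).topologicalClosure := by
      filter_upwards [hG.memW12Zero] with s hs
      exact hs.mem_topologicalClosure_testGraph
        (slice_ae_eq (hs.memW12.memLp.mono_exponent one_le_two)) (slice_ae_eq hs.memW12.memLp_grad)
    filter_upwards [(ae_restrict_iff' hIm).1 hslice] with s hs
    by_cases hsT : s ∈ Ioo 0 T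
    · simpa only [cylinderSlice, indicator_of_mem hsT] using hs hsT
    · simp only [cylinderSlice, indicator_of_notMem hsT]
      exact zero_mem _
  · have hwψ := integral_inner_convolution_indicator_slice hIm hIfin hu₁ (hψ.memLp ⊤) hρ.deriv t
    have hGψ := integral_inner_convolution_indicator_slice hIm hIfin hG₂ (hψ.memLp_gradient 2) hρ t
    have hgψ := integral_inner_convolution_indicator_slice hIm hIfin hg (hψ.memLp ⊤) hρ t
    have heqψ := heq ρ hρ t ht ψ hψ
    simp only [real_inner_eq_mul] at hwψ hgψ
    have hu₀ψ : ∫ x in Ω, hu₀.toLp u₀ x * ψ x = ∫ x in Ω, u₀ x * ψ x :=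
      integral_congr_ae (hu₀.coeFn_toLp.mono fun x hx => by simp only [hx])
    rw [hψ.integral_sub_smul_sub_mul, hu₀ψ, hwψ, hgψ]
    simp only [real_inner_smul_left, integral_const_mul, hGψ]
    linarith

theorem entropyDeriv_cylinderSlice_le {ε : ℝ} (hε : 0 < ε)
    (hdiv : DivNonpos Ω T b) (hb : MemLp b 2 (volume.restrict (cylinder Ω T)))
    (hf : MemLp f 1 (volume.restrict (cylinder Ω T))) {G : E n × ℝ → E n}
    (hG : MemLp G 2 (volume.restrict (cylinder Ω T))) {w : ℝ → Lp ℝ 1 (volume.restrict Ω)}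
    (hw : ∀ᵐ s, (w s, cylinderSlice Ω T 2 G s) ∈ (testGraph Ω).topologicalClosure) :
    ∀ᵐ s ∂(volume.restrict (Ioo 0 T)),
      entropyDeriv ε (w s) (cylinderSlice Ω T 1 (fun z => f z - inner ℝ (b z) (G z)) s) ≤
        ∫ x in Ω, |f (x, s)| := by
  have hdiv' := hdiv.ae_weakDivergenceNonpos_slice hb
  simp only [volume_restrict_cylinder] at hb hf hG
  filter_upwards [hdiv', ae_memLp_prodMk_right one_ne_zero ENNReal.one_ne_top hf,
    ae_memLp_prodMk_right two_ne_zero ENNReal.ofNat_ne_top hb,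
    ae_memLp_prodMk_right two_ne_zero ENNReal.ofNat_ne_top hG, ae_restrict_of_ae hw,
    ae_restrict_mem measurableSet_Ioo] with s hdivs hfs hbs hGs hws hs
  simp only [cylinderSlice, indicator_of_mem hs] at hws ⊢
  set B : Lp (E n) 2 (volume.restrict Ω) := slice 2 (volume.restrict Ω) b s
  have hbGs : MemLp (fun x => inner ℝ (b (x, s)) (G (x, s))) 1 (volume.restrict Ω) :=
    (innerSL ℝ (E := E n)).memLp_of_bilin 1 hbs hGs
  have hsplit : slice 1 (volume.restrict Ω) (fun z => f z - inner ℝ (b z) (G z)) s =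
      hfs.toLp - hbGs.toLp := by
    rw [← MemLp.toLp_sub]
    exact dif_pos (hfs.sub hbGs)
  have hdrift : 0 ≤ entropyDeriv ε (w s) hbGs.toLp := by
    refine entropyDeriv_inner_nonneg hε hdivs hws ?_
    filter_upwards [hbGs.coeFn_toLp, slice_ae_eq hbs, slice_ae_eq hGs] with x hx hbx hGx
    rw [hx, hbx, hGx]
  have hnorm : ‖hfs.toLp‖ = ∫ x in Ω, |f (x, s)| := by
    rw [L1.norm_eq_integral_norm]
    exact integral_congr_ae (hfs.coeFn_toLp.mono fun x hx => by simp only [hx, Real.norm_eq_abs])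
  rw [hsplit, entropyDeriv_sub hε, ← hnorm]
  linarith [(le_abs_self _).trans (abs_entropyDeriv_le hε (w s) hfs.toLp)]

end WeakSolutions

section MainTheorem

variable {n : ℕ} {Ω : Set (E n)} {T ν : ℝ} {b : E n × ℝ → E n} {u₀ : E n → ℝ}
  {f u : E n × ℝ → ℝ}

theorem IsWeakSolution.memLp (hu : IsWeakSolution Ω T ν b u₀ f u) :
    MemLp u 2 (volume.restrict (cylinder Ω T)) :=
  hu.choose_spec.1.memLp

theorem ae_cylinderSlice_ae_eq {V : Type*} [NormedAddCommGroup V] {p : ℝ≥0∞} (hp₀ : p ≠ 0)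
    (hp : p ≠ ⊤) {F : E n × ℝ → V} (hF : MemLp F p (volume.restrict (cylinder Ω T))) :
    ∀ᵐ t ∂(volume.restrict (Ioo 0 T)),
      cylinderSlice Ω T p F t =ᵐ[volume.restrict Ω] fun x => F (x, t) := by
  rw [volume_restrict_cylinder] at hF
  filter_upwards [ae_memLp_prodMk_right hp₀ hp hF, ae_restrict_mem measurableSet_Ioo] with t ht htT
  rw [cylinderSlice, indicator_of_mem htT]
  exact slice_ae_eq ht

theorem integrableOn_integral_abs (hf : MemLp f 1 (volume.restrict (cylinder Ω T))) :
    IntegrableOn (fun t => ∫ x in Ω, |f (x, t)|) (Ioc 0 T) := by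
  rw [volume_restrict_cylinder, memLp_one_iff_integrable] at hf
  rw [integrableOn_Ioc_iff_integrableOn_Ioo]
  exact hf.norm.integral_prod_right

theorem intervalIntegral_integral_abs_eq_zero
    (hf : ∀ᵐ z ∂(volume.restrict (cylinder Ω T)), f z = 0) {t₁ t₂ : ℝ} (ht₁ : 0 ≤ t₁)
    (ht : t₁ ≤ t₂) (ht₂ : t₂ ≤ T) : ∫ t in t₁..t₂, ∫ x in Ω, |f (x, t)| = 0 := by
  rw [volume_restrict_cylinder] at hf
  rw [intervalIntegral.integral_of_le ht, integral_Ioc_eq_integral_Ioo]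
  refine integral_eq_zero_of_ae ?_
  filter_upwards [ae_restrict_of_ae_restrict_of_subset (Ioo_subset_Ioo ht₁ ht₂)
    (ae_ae_of_ae_prod_right hf)] with t hft
  exact integral_eq_zero_of_ae (hft.mono fun x hx => by simp only [hx, abs_zero, Pi.zero_apply])

end MainTheorem

theorem mainTheorem1_general {n : ℕ} (Ω : Set (E n)) (hΩ : IsOpen Ω) (hΩfin : volume Ω ≠ ⊤)
    (T ν : ℝ) (hT : 0 ≤ T) (hν : 0 ≤ ν) (b : E n × ℝ → E n) (u₀ : E n → ℝ) (f u : E n × ℝ → ℝ)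
    (hb : MemLp b 2 (volume.restrict (cylinder Ω T))) (hu₀ : MemLp u₀ 1 (volume.restrict Ω))
    (hf : MemLp f 1 (volume.restrict (cylinder Ω T)))
    (hdiv : DivNonpos Ω T b) (hu : IsWeakSolution Ω T ν b u₀ f u) :
    ∃ v : ℝ → Lp ℝ 1 (volume.restrict Ω),
      ContinuousOn v (Icc 0 T) ∧
      (∀ᵐ t ∂(volume.restrict (Ioo 0 T)), ∀ᵐ x ∂(volume.restrict Ω), v t x = u (x, t)) ∧
      (∀ᵐ x ∂(volume.restrict Ω), v 0 x = u₀ x) ∧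
      (∀ t₁ t₂ : ℝ, 0 ≤ t₁ → t₁ ≤ t₂ → t₂ ≤ T →
        ‖v t₂‖ ≤ ‖v t₁‖ + ∫ t in t₁..t₂, ∫ x in Ω, |f (x, t)|) ∧
      ((∀ᵐ z ∂(volume.restrict (cylinder Ω T)), f z = 0) →
        AntitoneOn (fun t => ‖v t‖) (Icc 0 T)) := by
  have : IsFiniteMeasure (volume.restrict Ω) := isFiniteMeasure_restrict.2 hΩfin
  obtain ⟨G, hG, h⟩ := hu.exists_isHeatSolution hb hf hu₀
  have hu₁ : MemLp u 1 (volume.restrict (cylinder Ω T)) := by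
    have hfin : IsFiniteMeasure (volume.restrict (cylinder Ω T)) := by
      rw [volume_restrict_cylinder]
      infer_instance
    exact hu.memLp.mono_exponent one_le_two
  obtain ⟨v, hv⟩ := h.exists_tendstoUniformlyOn_timeApprox hΩ hν
  have hIoc : volume.restrict (Ioo 0 T) = volume.restrict (Ioc 0 T) := restrict_Ioo_eq_restrict_Ioc
  have hcontraction : ∀ t₁ t₂ : ℝ, 0 ≤ t₁ → t₁ ≤ t₂ → t₂ ≤ T →
      ‖v t₂‖ ≤ ‖v t₁‖ + ∫ t in t₁..t₂, ∫ x in Ω, |f (x, t)| := fun t₁ t₂ =>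
    h.norm_le_norm_add_integral hν hv (integrableOn_integral_abs hf) fun ε hε =>
      hIoc ▸ entropyDeriv_cylinderSlice_le hε hdiv hb hf hG h.mem_closure
  refine ⟨v, h.continuousOn_of_tendstoUniformlyOn hv, ?_, ?_, hcontraction, ?_⟩
  · filter_upwards [hIoc ▸ h.ae_eq_of_tendstoUniformlyOn hv,
      ae_cylinderSlice_ae_eq one_ne_zero ENNReal.one_ne_top
        hu₁] with t hvt hut
    rw [hvt]
    exact hut
  · rw [h.eq_initial_of_tendstoUniformlyOn hT hv]
    exact hu₀.coeFn_toLp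
  · intro hf₀ t₁ ht₁ t₂ ht₂ ht
    simpa only [intervalIntegral_integral_abs_eq_zero hf₀ ht₁.1 ht ht₂.2, add_zero] using
      hcontraction t₁ t₂ ht₁.1 ht ht₂.2

end ParabolicDrift

end

theorem mainTheorem1 {n : ℕ} (hn : 2 ≤ n) (Ω : Set (ParabolicDrift.E n))
    (hΩ : ParabolicDrift.IsBoundedLipschitzDomain Ω) (T ν : ℝ) (hT : 0 < T) (hν : 0 < ν)
    (b : ParabolicDrift.E n × ℝ → ParabolicDrift.E n) (u₀ : ParabolicDrift.E n → ℝ)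
    (f u : ParabolicDrift.E n × ℝ → ℝ)
    (hb : MemLp b 2 (volume.restrict (ParabolicDrift.cylinder Ω T)))
    (hu₀ : MemLp u₀ 2 (volume.restrict Ω))
    (hf : MemLp f 1 (volume.restrict (ParabolicDrift.cylinder Ω T)))
    (hdiv : ParabolicDrift.DivNonpos Ω T b)
    (hu : ParabolicDrift.IsWeakSolution Ω T ν b u₀ f u) :
    ∃ v : ℝ → Lp ℝ 1 (volume.restrict Ω),
      ContinuousOn v (Icc 0 T) ∧
      (∀ᵐ t ∂(volume.restrict (Ioo (0 : ℝ) T)),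
        ∀ᵐ x ∂(volume.restrict Ω), v t x = u (x, t)) ∧
      (∀ᵐ x ∂(volume.restrict Ω), v 0 x = u₀ x) ∧
      (∀ t₁ t₂ : ℝ, 0 ≤ t₁ → t₁ ≤ t₂ → t₂ ≤ T →
        ‖v t₂‖ ≤ ‖v t₁‖ + ∫ t in t₁..t₂, ∫ x in Ω, |f (x, t)|) ∧
      ((∀ᵐ z ∂(volume.restrict (ParabolicDrift.cylinder Ω T)), f z = 0) →
        AntitoneOn (fun t => ‖v t‖) (Icc 0 T)) := by
  have : IsFiniteMeasure (volume.restrict Ω) :=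
    isFiniteMeasure_restrict.2 hΩ.isBounded.measure_lt_top.ne
  exact ParabolicDrift.mainTheorem1_general Ω hΩ.isOpen hΩ.isBounded.measure_lt_top.ne T ν hT.le
    hν.le b u₀ f u hb (hu₀.mono_exponent one_le_two) hf hdiv hu
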